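/- For an odd prime power $q$ such that $3$ is a square in $\mathbb F_q$, and $t\in\mathbb F_q^*$, write $\|x\|=x_1^2+x_2^2$ for $x\in\mathbb F_q^2$, let $S_t=\{x\in\mathbb F_q^2:\|x\|=t\}$, identified with its indicator function, and for $f_1,f_2,f_3:\mathbb F_q^2\to[0,\infty)$ let $$\Delta(f_1,f_2,f_3)=\frac{1}{q^2|S_t|}\sum_{x^1,x^2,x^3\in\mathbb F_q^2}S_t(x^1-x^2)\,S_t(x^2-x^3)\,S_t(x^3-x^1)\,f_1(x^1)f_2(x^2)f_3(x^3).$$ Let $\|f\|_p=\bigl(q^{-2}\sum_{x}|f(x)|^p\bigr)^{1/p}$ for $1\le p<\infty$ and $\|f\|_\infty=\max_x|f(x)|$. For $1\le p_1,p_2,p_3\le\infty$ let $\Delta(p_1,p_2,p_3)$ (which depends on $q$ and $t$) be the best constant $C$ in $$\Delta(f_1,f_2,f_3)\le C\,\|f_1\|_{p_1}\|f_2\|_{p_2}\|f_3\|_{p_3}\qquad\text{for all non-negative } f_1,f_2,f_3 .$$ For a family $\mathcal Q$ of pairs $(\mathbb F_q,t)$ as above, say that $\Delta(p_1,p_2,p_3)\lesssim1$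 along $\mathcal Q$ if there is a constant $C\ge1$, independent of $q$ and $t$, with $\Delta(p_1,p_2,p_3)\le C$ for all members of $\mathcal Q$. **Theorem.** Let $1\le p_1,p_2,p_3\le\infty$, with the convention $1/\infty=0$. (i) Let $\mathcal Q$ be any family of such pairs in which $q$ is unbounded (for example, all such pairs). If $\Delta(p_1,p_2,p_3)\lesssim1$ along $\mathcal Q$, then $$\frac2{p_1}+\frac1{p_2}+\frac1{p_3}\le2,\qquad \frac1{p_1}+\frac2{p_2}+\frac1{p_3}\le2,\qquad \frac1{p_1}+\frac1{p_2}+\frac2{p_3}\le2.$$ (ii) Conversely, if all three inequalities hold and $(p_1,p_2,p_3)\ne(2,2,2)$, then $\Delta(p_1,p_2,p_3)\lesssim1$ along the family of all such pairs. At $(2,2,2)$ the restricted strong-type estimate holds: there is a constant $C\ge1$ such that for all such $q$ and $t$ and all subsets $E_1,E_2,E_3\subseteq\mathbb F_q^2$, $$\Delta(1_{E_1},1_{E_2},1_{E_3})\le C\,\|1_{E_1}\|_2\,\|1_{E_2}\|_2\,\|1_{E_3}\|_2 .$$ -/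

import Mathlib

open scoped ENNReal

noncomputable section

namespace KThree

/-- The plane `F_q^2` over a field `F = F_q`. -/
abbrev Plane (F : Type) : Type := Fin 2 → F

/-- The circle `S_t = {x : x_1^2 + x_2^2 = t}` in `F_q^2`. -/
def circle {F : Type} [Field F] (t : F) : Set (Plane F) := {x | x 0 ^ 2 + x 1 ^ 2 = t}

/-- The indicator function of a subset of `F_q^2`. -/
def ind {F : Type} (E : Set (Plane F)) : Plane F → ℝ := E.indicator (fun _ => 1)

/-- The norm `‖f‖_p` on `F_q^2` with respect to the normalized counting measure
(the maximum of `|f|` when `p = ∞`). -/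
def lpNorm {F : Type} [Fintype F] (p : ℝ≥0∞) (f : Plane F → ℝ) : ℝ :=
  if p = ∞ then ⨆ x, |f x|
  else (((Fintype.card F : ℝ) ^ 2)⁻¹ * ∑ x, |f x| ^ p.toReal) ^ (1 / p.toReal)

/-- The trilinear form of the graph `K_3` on `F_q^2`, normalized by `q^2 |S_t|`. -/
def form {F : Type} [Field F] [Fintype F] (t : F) (f₁ f₂ f₃ : Plane F → ℝ) : ℝ :=
  1 / ((Fintype.card F : ℝ) ^ 2 * ((circle t).ncard : ℝ)) *
    ∑ x₁, ∑ x₂, ∑ x₃,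
      ind (circle t) (x₁ - x₂) * ind (circle t) (x₂ - x₃) * ind (circle t) (x₃ - x₁) *
        (f₁ x₁ * f₂ x₂ * f₃ x₃)

/-- `Δ(p₁, p₂, p₃)`: the best constant in
`Δ(f₁, f₂, f₃) ≤ C ‖f₁‖_{p₁} ‖f₂‖_{p₂} ‖f₃‖_{p₃}` over non-negative functions. -/
def bestConst {F : Type} [Field F] [Fintype F] (t : F) (p₁ p₂ p₃ : ℝ≥0∞) : ℝ :=
  sInf {C : ℝ | 0 < C ∧ ∀ f₁ f₂ f₃ : Plane F → ℝ,
    (∀ x, 0 ≤ f₁ x) → (∀ x, 0 ≤ f₂ x) → (∀ x, 0 ≤ f₃ x) →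
      form t f₁ f₂ f₃ ≤ C * (lpNorm p₁ f₁ * lpNorm p₂ f₂ * lpNorm p₃ f₃)}

/-- An admissible pair `(F_q, t)`: a finite field of odd order in which `3` is a square, and a
non-zero radius `t`. -/
structure Datum where
  /-- the field `F_q` -/
  F : Type
  [field : Field F]
  [fintype : Fintype F]
  /-- the radius -/
  t : F
  t_ne_zero : t ≠ 0
  two_ne_zero : (2 : F) ≠ 0
  isSquare_three : IsSquare (3 : F)

attribute [instance] Datum.field Datum.fintype

/-- `q`, the order of the field. -/
def Datum.q (D : Datum) : ℕ := Fintype.card D.F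

/-- The family contains pairs `(F_q, t)` with `q` arbitrarily large. -/
def Unbounded (𝒬 : Set Datum) : Prop := ∀ N : ℕ, ∃ D ∈ 𝒬, N ≤ D.q

/-- `Δ(p₁, p₂, p₃) ≲ 1` along the family `𝒬`: the constant depends neither on `q` nor on `t`. -/
def LesssimOne (𝒬 : Set Datum) (p₁ p₂ p₃ : ℝ≥0∞) : Prop :=
  ∃ C : ℝ, 1 ≤ C ∧ ∀ D ∈ 𝒬, bestConst D.t p₁ p₂ p₃ ≤ C

/-- The restricted strong-type `Δ(p₁, p₂, p₃)` estimate along the family `𝒬`: the estimate for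
indicator functions of arbitrary sets, with a constant independent of `q` and `t`. -/
def RestrictedStrongType (𝒬 : Set Datum) (p₁ p₂ p₃ : ℝ≥0∞) : Prop :=
  ∃ C : ℝ, 1 ≤ C ∧ ∀ D ∈ 𝒬, ∀ E₁ E₂ E₃ : Set (Plane D.F),
    form D.t (ind E₁) (ind E₂) (ind E₃) ≤
      C * (lpNorm p₁ (ind E₁) * lpNorm p₂ (ind E₂) * lpNorm p₃ (ind E₃))

/-- The three inequalities on the exponents (`1 / ∞ = 0`). -/
def ExponentCondition (p₁ p₂ p₃ : ℝ≥0∞) : Prop :=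
  2 / p₁ + 1 / p₂ + 1 / p₃ ≤ 2 ∧ 1 / p₁ + 2 / p₂ + 1 / p₃ ≤ 2 ∧ 1 / p₁ + 1 / p₂ + 2 / p₃ ≤ 2

lemma lpNorm_nonneg {F : Type} [Fintype F] (p : ℝ≥0∞) (f : Plane F → ℝ) : 0 ≤ lpNorm p f := by
  unfold lpNorm
  split_ifs
  · exact Real.iSup_nonneg fun x => abs_nonneg _
  · positivity

lemma exists_le_lpNorm {F : Type} [Field F] [Fintype F] (p : ℝ≥0∞) (hp : 1 ≤ p) :
    ∃ M : ℝ, 0 < M ∧ ∀ (f : Plane F → ℝ) (x : Plane F), |f x| ≤ M * lpNorm p f := by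
  by_cases h : p = ∞
  · refine ⟨1, one_pos, fun f x => ?_⟩
    simp only [lpNorm, h, if_true, one_mul]
    exact le_ciSup (f := fun x => |f x|) (Set.finite_range _).bddAbove x
  · have hpos : 0 < p.toReal := ENNReal.toReal_pos (by positivity) h
    have hq : (0 : ℝ) < (Fintype.card F : ℝ) ^ 2 := by
      have : 0 < Fintype.card F := Fintype.card_pos
      positivity
    refine ⟨((Fintype.card F : ℝ) ^ 2) ^ (1 / p.toReal), by positivity, fun f x => ?_⟩
    simp only [lpNorm, h, if_false]
    have hs : 0 ≤ ∑ x, |f x| ^ p.toReal := by positivity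
    rw [← Real.mul_rpow hq.le (by positivity), mul_inv_cancel_left₀ hq.ne']
    have h1 : |f x| ^ p.toReal ≤ ∑ x, |f x| ^ p.toReal :=
      Finset.single_le_sum (f := fun x => |f x| ^ p.toReal) (fun i _ => by positivity)
        (Finset.mem_univ x)
    calc |f x| = (|f x| ^ p.toReal) ^ (1 / p.toReal) := by
          rw [one_div, Real.rpow_rpow_inv (abs_nonneg _) hpos.ne']
      _ ≤ _ := Real.rpow_le_rpow (by positivity) h1 (by positivity)

lemma ind_nonneg {F : Type} (E : Set (Plane F)) (x : Plane F) : 0 ≤ ind E x :=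
  Set.indicator_nonneg (fun _ _ => zero_le_one) x

/-- The set that defines the best constant is non-empty. -/
lemma exists_bound {F : Type} [Field F] [Fintype F] (t : F) (p₁ p₂ p₃ : ℝ≥0∞)
    (h₁ : 1 ≤ p₁) (h₂ : 1 ≤ p₂) (h₃ : 1 ≤ p₃) :
    ∃ C : ℝ, 0 < C ∧ ∀ f₁ f₂ f₃ : Plane F → ℝ,
      (∀ x, 0 ≤ f₁ x) → (∀ x, 0 ≤ f₂ x) → (∀ x, 0 ≤ f₃ x) →
        form t f₁ f₂ f₃ ≤ C * (lpNorm p₁ f₁ * lpNorm p₂ f₂ * lpNorm p₃ f₃) := by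
  obtain ⟨M₁, hM₁, H₁⟩ := exists_le_lpNorm (F := F) p₁ h₁
  obtain ⟨M₂, hM₂, H₂⟩ := exists_le_lpNorm (F := F) p₂ h₂
  obtain ⟨M₃, hM₃, H₃⟩ := exists_le_lpNorm (F := F) p₃ h₃
  set c : ℝ := 1 / ((Fintype.card F : ℝ) ^ 2 * ((circle t).ncard : ℝ)) with hc
  have hc0 : 0 ≤ c := by positivity
  set S : ℝ := ∑ x₁ : Plane F, ∑ x₂ : Plane F, ∑ x₃ : Plane F,
    ind (circle t) (x₁ - x₂) * ind (circle t) (x₂ - x₃) * ind (circle t) (x₃ - x₁) with hS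
  have hS0 : 0 ≤ S := Finset.sum_nonneg fun i _ => Finset.sum_nonneg fun j _ =>
    Finset.sum_nonneg fun k _ => mul_nonneg (mul_nonneg (ind_nonneg _ _) (ind_nonneg _ _))
      (ind_nonneg _ _)
  refine ⟨c * S * (M₁ * M₂ * M₃) + 1, by positivity, fun f₁ f₂ f₃ n₁ n₂ n₃ => ?_⟩
  have N₁ := lpNorm_nonneg p₁ f₁
  have N₂ := lpNorm_nonneg p₂ f₂
  have N₃ := lpNorm_nonneg p₃ f₃
  have key : form t f₁ f₂ f₃ ≤
      c * (S * ((M₁ * lpNorm p₁ f₁) * (M₂ * lpNorm p₂ f₂) * (M₃ * lpNorm p₃ f₃))) := by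
    unfold form
    refine mul_le_mul_of_nonneg_left ?_ hc0
    rw [hS]
    simp only [Finset.sum_mul]
    refine Finset.sum_le_sum fun i _ => Finset.sum_le_sum fun j _ => Finset.sum_le_sum fun k _ => ?_
    refine mul_le_mul_of_nonneg_left ?_ (mul_nonneg (mul_nonneg (ind_nonneg _ _) (ind_nonneg _ _))
      (ind_nonneg _ _))
    have a₁ := (le_abs_self _).trans (H₁ f₁ i)
    have a₂ := (le_abs_self _).trans (H₂ f₂ j)
    have a₃ := (le_abs_self _).trans (H₃ f₃ k)
    have m₁ := n₁ i
    have m₂ := n₂ j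
    have m₃ := n₃ k
    gcongr
  have : 0 ≤ lpNorm p₁ f₁ * lpNorm p₂ f₂ * lpNorm p₃ f₃ := by positivity
  nlinarith [key]

/-- The best constant is attained: it is itself an admissible constant. -/
lemma form_le_bestConst {F : Type} [Field F] [Fintype F] (t : F) (p₁ p₂ p₃ : ℝ≥0∞)
    (h₁ : 1 ≤ p₁) (h₂ : 1 ≤ p₂) (h₃ : 1 ≤ p₃) (f₁ f₂ f₃ : Plane F → ℝ)
    (n₁ : ∀ x, 0 ≤ f₁ x) (n₂ : ∀ x, 0 ≤ f₂ x) (n₃ : ∀ x, 0 ≤ f₃ x) :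
    form t f₁ f₂ f₃ ≤ bestConst t p₁ p₂ p₃ *
      (lpNorm p₁ f₁ * lpNorm p₂ f₂ * lpNorm p₃ f₃) := by
  obtain ⟨C, hC⟩ := exists_bound t p₁ p₂ p₃ h₁ h₂ h₃
  have hP : 0 ≤ lpNorm p₁ f₁ * lpNorm p₂ f₂ * lpNorm p₃ f₃ :=
    mul_nonneg (mul_nonneg (lpNorm_nonneg _ _) (lpNorm_nonneg _ _)) (lpNorm_nonneg _ _)
  rcases hP.eq_or_lt with h | h
  · have := hC.2 f₁ f₂ f₃ n₁ n₂ n₃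
    rw [← h] at this ⊢
    simpa using this
  · rw [← div_le_iff₀ h]
    refine le_csInf ⟨C, hC⟩ fun D hD => ?_
    rw [div_le_iff₀ h]
    exact hD.2 f₁ f₂ f₃ n₁ n₂ n₃

/-- The family of all admissible pairs contains arbitrarily large fields. -/
lemma unbounded_univ : Unbounded Set.univ := by
  intro N
  have : Fact (Nat.Prime 11) := ⟨by norm_num⟩
  have hN : N + 1 ≠ 0 := by omega
  have : Fintype (GaloisField 11 (N + 1)) := Fintype.ofFinite _
  have h2 : (2 : GaloisField 11 (N + 1)) ≠ 0 := by
    intro h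
    have h' : ((2 : ℕ) : GaloisField 11 (N + 1)) = 0 := by exact_mod_cast h
    rw [CharP.cast_eq_zero_iff (GaloisField 11 (N + 1)) 11] at h'
    omega
  have h3 : IsSquare (3 : GaloisField 11 (N + 1)) := by
    refine ⟨5, ?_⟩
    have h' : ((22 : ℕ) : GaloisField 11 (N + 1)) = 0 := by
      rw [CharP.cast_eq_zero_iff (GaloisField 11 (N + 1)) 11]; norm_num
    have : (5 : GaloisField 11 (N + 1)) * 5 = 3 + ((22 : ℕ) : GaloisField 11 (N + 1)) := by
      norm_num
    rw [this, h', add_zero]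
  refine ⟨⟨GaloisField 11 (N + 1), 1, one_ne_zero, h2, h3⟩, trivial, ?_⟩
  show N ≤ Fintype.card (GaloisField 11 (N + 1))
  rw [← Nat.card_eq_fintype_card, GaloisField.card 11 (N + 1) hN]
  exact (Nat.le_succ N).trans (Nat.lt_pow_self (by norm_num)).le

end KThree

end

namespace KThree

/-! ### Inequalities for finite sums -/

section Graph

open Finset

/-! Join two points of the plane when their difference lies on the circle. Since `t ≠ 0` and `2 ≠
0`, two distinct points have at most two common neighbours (`codegreeLeTwo_circleGraph`), and the
degree |S_t| lies between q/4 and 2q. The upper bounds use nothing else: they are estimates for sums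
over triangles of a graph with these properties.

By symmetry let u₁ ≥ u₂ ≥ u₃ be the reciprocals of the exponents. The admissible region is then the
simplex with vertices (1/2,1/2,1/2), (2/3,2/3,0), (1,0,0) and (0,0,0). The last two are triangle
counts. At (2/3,2/3,0), edges lie in at most two triangles, and Hölder leaves the third moment of a
neighbourhood sum, where the diagonal must be treated separately (`sum_neighbor_pow_three_le`). At
(1/2,1/2,1/2), Cauchy–Schwarz at one vertex leads to pairs of triangles sharing it; regrouping their
four other vertices makes each fibre bounded (`sum_triangles_mul_sq_le`). This gives the strong-type
bound even at (2,2,2).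

No interpolation theorem is needed: each function is its norm times a power of a normalized density
(`exists_density`), and weighted AM–GM inside the triangle sum combines the vertices
(`sum_triangles_rpow_le`).

For necessity, test on a point and two copies of the circle around it. As 3 is a square, rotation by
60° is defined over the field and yields at least |S_t| triangles (`le_form_ind`). -/

lemma sum_comp_le_mul_sum {ι κ : Type*} [Fintype κ] [DecidableEq κ] (s : Finset ι) (π : ι → κ)
    (k : ℕ) (h : ∀ y, #{i ∈ s | π i = y} ≤ k) (φ : κ → ℝ) (hφ : ∀ y, 0 ≤ φ y) :
    ∑ i ∈ s, φ (π i) ≤ k * ∑ y, φ y := by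
  rw [← Finset.sum_fiberwise s π, Finset.mul_sum]
  refine Finset.sum_le_sum fun y _ => ?_
  rw [Finset.sum_congr rfl (g := fun _ => φ y) fun i hi => by rw [(Finset.mem_filter.1 hi).2],
    Finset.sum_const, nsmul_eq_mul]
  exact mul_le_mul_of_nonneg_right (by exact_mod_cast h y) (hφ y)

lemma card_le_mul_of_fiber {α β : Type*} [DecidableEq α] [DecidableEq β] (s : Finset (α × β))
    (t : Finset α) (u : α → Finset β) {m n : ℕ} (ht : #t ≤ m) (hu : ∀ a ∈ t, #(u a) ≤ n)
    (h : ∀ x ∈ s, x.1 ∈ t ∧ x.2 ∈ u x.1) : #s ≤ m * n := by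
  calc #s ≤ #(t.sigma u) := by
        refine Finset.card_le_card_of_injOn (fun x => ⟨x.1, x.2⟩) (fun x hx => ?_) ?_
        · simpa using h x hx
        · rintro ⟨a, b⟩ _ ⟨a', b'⟩ _ hab
          simp only [Sigma.mk.injEq, heq_eq_eq] at hab
          simp [hab.1, hab.2]
    _ = ∑ a ∈ t, #(u a) := Finset.card_sigma _ _
    _ ≤ #t * n := Finset.sum_le_card_nsmul _ _ _ hu
    _ ≤ m * n := Nat.mul_le_mul_right _ ht

/-- With P = ∑ g² and Q = ∑ g³, Cauchy–Schwarz gives P² ≤ (∑ g) Q and (∑ g)² ≤ #s P; eliminate ∑ g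
and cancel P. -/
lemma sum_sq_pow_three_le {ι : Type*} (s : Finset ι) (g : ι → ℝ) (hg : ∀ i, 0 ≤ g i) :
    (∑ i ∈ s, g i ^ 2) ^ 3 ≤ #s * (∑ i ∈ s, g i ^ 3) ^ 2 := by
  set P := ∑ i ∈ s, g i ^ 2
  set Q := ∑ i ∈ s, g i ^ 3
  have hP : 0 ≤ P := Finset.sum_nonneg fun i _ => by positivity
  have h1 : P ^ 2 ≤ (∑ i ∈ s, g i) * Q :=
    Finset.sum_sq_le_sum_mul_sum_of_sq_le_mul s (fun i _ => hg i)
      (fun i _ => pow_nonneg (hg i) 3) (fun i _ => le_of_eq (by ring))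
  have h2 : (∑ i ∈ s, g i) ^ 2 ≤ #s * P := sq_sum_le_card_mul_sum_sq
  rcases hP.eq_or_lt with h | h
  · rw [← h, zero_pow three_ne_zero]
    exact mul_nonneg (Nat.cast_nonneg _) (sq_nonneg _)
  · have h3 : (P ^ 2) ^ 2 ≤ ((∑ i ∈ s, g i) * Q) ^ 2 := pow_le_pow_left₀ (by positivity) h1 2
    have h4 : ((∑ i ∈ s, g i) * Q) ^ 2 ≤ #s * P * Q ^ 2 := by
      rw [mul_pow]; exact mul_le_mul_of_nonneg_right h2 (sq_nonneg _)
    refine le_of_mul_le_mul_left ?_ h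
    linarith [h3, h4]

/-- Cubing a sum of squares costs the diagonal only once: the largest term is separated. -/
lemma sum_sq_pow_three_le_offDiag {ι : Type*} [DecidableEq ι] (s : Finset ι) (g : ι → ℝ)
    (hg : ∀ i, 0 ≤ g i) :
    (∑ i ∈ s, g i ^ 2) ^ 3 ≤
      4 * ∑ i ∈ s, g i ^ 6 + 8 * #s * ∑ p ∈ s.offDiag, g p.1 ^ 3 * g p.2 ^ 3 := by
  rcases s.eq_empty_or_nonempty with rfl | hs
  · simp
  obtain ⟨m, hm, hmax⟩ := s.exists_max_image g hs
  set O := ∑ p ∈ s.offDiag, g p.1 ^ 3 * g p.2 ^ 3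
  have hnn : ∀ p : ι × ι, 0 ≤ g p.1 ^ 3 * g p.2 ^ 3 := fun p =>
    mul_nonneg (pow_nonneg (hg _) 3) (pow_nonneg (hg _) 3)
  -- Away from the maximum at m, a diagonal term is dominated by the off-diagonal term of the pair
  -- (i, m).
  have e1 : ∑ i ∈ s.erase m, g i ^ 6 ≤ O := by
    calc ∑ i ∈ s.erase m, g i ^ 6 ≤ ∑ i ∈ s.erase m, g i ^ 3 * g m ^ 3 := by
          refine Finset.sum_le_sum fun i hi => ?_
          rw [show g i ^ 6 = g i ^ 3 * g i ^ 3 by ring]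
          exact mul_le_mul_of_nonneg_left
            (pow_le_pow_left₀ (hg i) (hmax i (Finset.mem_of_mem_erase hi)) 3)
            (pow_nonneg (hg i) 3)
      _ = ∑ p ∈ (s.erase m).image (fun i => (i, m)), g p.1 ^ 3 * g p.2 ^ 3 := by
          rw [Finset.sum_image]
          intro a _ b _ hab
          exact (Prod.mk.inj hab).1
      _ ≤ O := by
          refine Finset.sum_le_sum_of_subset_of_nonneg ?_ fun p _ _ => hnn p
          intro p hp
          obtain ⟨i, hi, rfl⟩ := Finset.mem_image.1 hp
          exact Finset.mem_offDiag.2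
            ⟨Finset.mem_of_mem_erase hi, hm, Finset.ne_of_mem_erase hi⟩
  have e2 : (∑ i ∈ s.erase m, g i ^ 3) ^ 2 ≤ 2 * O := by
    have : (∑ i ∈ s.erase m, g i ^ 3) ^ 2 =
        ∑ i ∈ s.erase m, g i ^ 6 + ∑ p ∈ (s.erase m).offDiag, g p.1 ^ 3 * g p.2 ^ 3 := by
      rw [sq, Finset.sum_mul_sum, ← Finset.sum_product', ← Finset.diag_union_offDiag,
        Finset.sum_union (Finset.disjoint_diag_offDiag _), Finset.sum_diag]
      congr 1
      exact Finset.sum_congr rfl fun i _ => by ring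
    have h2 : ∑ p ∈ (s.erase m).offDiag, g p.1 ^ 3 * g p.2 ^ 3 ≤ O :=
      Finset.sum_le_sum_of_subset_of_nonneg
        (Finset.offDiag_mono (Finset.erase_subset _ _)) fun p _ _ => hnn p
    linarith
  have e3 := sum_sq_pow_three_le (s.erase m) g hg
  have e4 : (#(s.erase m) : ℝ) ≤ #s := by exact_mod_cast Finset.card_le_card (s.erase_subset m)
  have hO : 0 ≤ O := Finset.sum_nonneg fun p _ => hnn p
  have e5 : (∑ i ∈ s.erase m, g i ^ 2) ^ 3 ≤ #s * (2 * O) :=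
    e3.trans (mul_le_mul e4 e2 (sq_nonneg _) (by positivity))
  have e6 : g m ^ 6 ≤ ∑ i ∈ s, g i ^ 6 :=
    Finset.single_le_sum (f := fun i => g i ^ 6) (fun i _ => pow_nonneg (hg i) 6) hm
  have hR : 0 ≤ ∑ i ∈ s.erase m, g i ^ 2 := Finset.sum_nonneg fun i _ => sq_nonneg _
  rw [← Finset.add_sum_erase s (fun i => g i ^ 2) hm]
  -- Convexity costs 2² = 4; the remainder then contributes 4 · 2 = 8.
  have e7 := add_pow_le (sq_nonneg (g m)) hR 3
  norm_num at e7
  nlinarith [e7, e5, e6]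

/-! ### Graphs of codegree at most two: the estimates at (1, ∞, ∞) and (3/2, 3/2, ∞) -/

variable {V : Type*} [Fintype V] [DecidableEq V]

/-- The ordered triangles of a graph. -/
def triangles (G : SimpleGraph V) [DecidableRel G.Adj] : Finset (V × V × V) :=
  {x | G.Adj x.1 x.2.1 ∧ G.Adj x.2.1 x.2.2 ∧ G.Adj x.2.2 x.1}

/-- Any two distinct vertices have at most two common neighbours. -/
def CodegreeLeTwo (G : SimpleGraph V) [DecidableRel G.Adj] : Prop :=
  ∀ a b, a ≠ b → #{c | G.Adj a c ∧ G.Adj b c} ≤ 2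

variable {G : SimpleGraph V} [DecidableRel G.Adj]

/-- A vertex has at most d choices of a neighbour, and the edge so formed at most two completions to
a triangle. This settles the exponents (1, ∞, ∞) and (∞, ∞, ∞). -/
lemma sum_triangles_fst_le (hG : CodegreeLeTwo G) {d : ℕ} (hd : ∀ a, #{b | G.Adj a b} ≤ d)
    (f : V → ℝ) (hf : ∀ a, 0 ≤ f a) :
    ∑ x ∈ triangles G, f x.1 ≤ (d * 2 : ℕ) * ∑ a, f a := by
  refine sum_comp_le_mul_sum _ (fun x : V × V × V => x.1) _ (fun a => ?_) f hf
  have key := card_le_mul_of_fiber ({x ∈ triangles G | x.1 = a}.image Prod.snd)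
    {b | G.Adj a b} (fun b => {c | G.Adj a c ∧ G.Adj b c}) (hd a)
    (fun b hb => hG a b (by simpa using (Finset.mem_filter.1 hb).2.ne)) (by
      rintro ⟨b, c⟩ hx
      obtain ⟨⟨a', b', c'⟩, h, e⟩ := Finset.mem_image.1 hx
      simp only [triangles, Finset.mem_filter, Finset.mem_univ, true_and, Prod.mk.injEq] at h e ⊢
      obtain ⟨rfl, rfl⟩ := e
      obtain ⟨⟨h1, h2, h3⟩, rfl⟩ := h
      exact ⟨h1, h3.symm, h2⟩)
  rwa [Finset.card_image_of_injOn] at key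
  rintro ⟨a₁, y₁⟩ h1 ⟨a₂, y₂⟩ h2 e
  simp only [Finset.coe_filter, Set.mem_ofPred_eq] at h1 h2 e
  rw [h1.2, h2.2, e]

lemma sum_triangles_edge_le (hG : CodegreeLeTwo G) (φ : V → V → ℝ) (hφ : ∀ a b, 0 ≤ φ a b) :
    ∑ x ∈ triangles G, φ x.1 x.2.1 ≤ 2 * ∑ b, ∑ a ∈ {a | G.Adj b a}, φ a b := by
  have key := sum_comp_le_mul_sum (triangles G) (fun x : V × V × V => (x.1, x.2.1)) 2
    (fun y => ?_) (fun y => if G.Adj y.1 y.2 then φ y.1 y.2 else 0)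
    (fun y => by split_ifs; exacts [hφ _ _, le_rfl])
  · calc ∑ x ∈ triangles G, φ x.1 x.2.1 = _ := Finset.sum_congr rfl fun x hx => by
          rw [if_pos (Finset.mem_filter.1 hx).2.1]
      _ ≤ _ := key
      _ = _ := by
          rw [Fintype.sum_prod_type_right]
          simp only [Finset.sum_filter, Nat.cast_ofNat, G.adj_comm]
  · obtain ⟨a, b⟩ := y
    by_cases hab : a = b
    · rw [Finset.filter_eq_empty_iff.2]
      · simp
      · rintro ⟨a', b', c'⟩ hx e
        simp only [Prod.mk.injEq] at e
        have := (Finset.mem_filter.1 hx).2.1.ne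
        simp [e.1, e.2, hab] at this
    · refine le_trans ?_ (hG a b hab)
      refine Finset.card_le_card_of_injOn (fun x => x.2.2) ?_ ?_
      · rintro ⟨a', b', c'⟩ hx
        simp only [triangles, Finset.coe_filter, Finset.mem_filter, Finset.mem_univ, true_and,
          Prod.mk.injEq, Set.mem_ofPred_eq] at hx ⊢
        obtain ⟨⟨h1, h2, h3⟩, rfl, rfl⟩ := hx
        exact ⟨h3.symm, h2⟩
      · rintro ⟨a₁, b₁, c₁⟩ h1 ⟨a₂, b₂, c₂⟩ h2 e
        simp only [Finset.coe_filter, Set.mem_ofPred_eq, Prod.mk.injEq] at h1 h2 e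
        simp [h1.2, h2.2, e]

/-- An off-diagonal pair has at most two common neighbours, so only the diagonal sees the degree.
The plain bound `sum_sq_pow_three_le` would put the factor #s on the diagonal too and give d²
instead of d. The constant is 4 + 8 · 2 = 20. -/
lemma sum_neighbor_pow_three_le (hG : CodegreeLeTwo G) {d : ℕ} (hd : ∀ a, #{b | G.Adj a b} ≤ d)
    (g : V → ℝ) (hg : ∀ a, 0 ≤ g a) :
    ∑ b, (∑ a ∈ {a | G.Adj b a}, g a ^ 2) ^ 3 ≤ 20 * d * (∑ a, g a ^ 3) ^ 2 := by
  have hN : 0 ≤ ∑ a, g a ^ 3 := Finset.sum_nonneg fun a _ => pow_nonneg (hg a) 3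
  have h6 : ∑ a, g a ^ 6 ≤ (∑ a, g a ^ 3) ^ 2 := by
    rw [sq, Finset.sum_mul]
    refine Finset.sum_le_sum fun a _ => ?_
    rw [show g a ^ 6 = g a ^ 3 * g a ^ 3 by ring]
    exact mul_le_mul_of_nonneg_left (Finset.single_le_sum (f := fun a => g a ^ 3)
      (fun a _ => pow_nonneg (hg a) 3) (Finset.mem_univ a)) (pow_nonneg (hg a) 3)
  have hD : ∑ b, ∑ a ∈ {a | G.Adj b a}, g a ^ 6 ≤ d * ∑ a, g a ^ 6 := by
    simp only [Finset.sum_filter]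
    rw [Finset.sum_comm, Finset.mul_sum]
    refine Finset.sum_le_sum fun a _ => ?_
    rw [← Finset.sum_filter, Finset.sum_const, nsmul_eq_mul]
    refine mul_le_mul_of_nonneg_right ?_ (pow_nonneg (hg a) 6)
    simp only [G.adj_comm _ a]
    exact_mod_cast hd a
  have hO : ∑ b, ∑ p ∈ ({a | G.Adj b a} : Finset V).offDiag, g p.1 ^ 3 * g p.2 ^ 3 ≤
      2 * (∑ a, g a ^ 3) ^ 2 := by
    rw [sq, Finset.sum_mul_sum, ← Fintype.sum_prod_type', Finset.mul_sum]
    have : ∀ b, ∑ p ∈ ({a | G.Adj b a} : Finset V).offDiag, g p.1 ^ 3 * g p.2 ^ 3 =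
        ∑ p : V × V, if G.Adj b p.1 ∧ G.Adj b p.2 ∧ p.1 ≠ p.2 then g p.1 ^ 3 * g p.2 ^ 3 else 0 :=
      fun b => by
        rw [← Finset.sum_filter]
        refine Finset.sum_congr ?_ fun _ _ => rfl
        ext p; simp [Finset.mem_offDiag]
    simp only [this]
    rw [Finset.sum_comm]
    refine Finset.sum_le_sum fun p _ => ?_
    have hp : 0 ≤ g p.1 ^ 3 * g p.2 ^ 3 := mul_nonneg (pow_nonneg (hg _) 3) (pow_nonneg (hg _) 3)
    rw [← Finset.sum_filter, Finset.sum_const, nsmul_eq_mul]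
    refine mul_le_mul_of_nonneg_right ?_ hp
    by_cases h : p.1 = p.2
    · simp [h]
    · refine le_trans ?_ (Nat.cast_le.2 (hG p.1 p.2 h))
      refine Nat.cast_le.2 (Finset.card_le_card fun b => ?_)
      simp only [Finset.mem_filter, Finset.mem_univ, true_and]
      exact fun hb => ⟨hb.1.symm, hb.2.1.symm⟩
  calc ∑ b, (∑ a ∈ {a | G.Adj b a}, g a ^ 2) ^ 3
      ≤ ∑ b, (4 * ∑ a ∈ {a | G.Adj b a}, g a ^ 6 + 8 * d *
          ∑ p ∈ ({a | G.Adj b a} : Finset V).offDiag, g p.1 ^ 3 * g p.2 ^ 3) := by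
        refine Finset.sum_le_sum fun b _ => (sum_sq_pow_three_le_offDiag _ g hg).trans ?_
        have hb : (#{a | G.Adj b a} : ℝ) ≤ d := by exact_mod_cast hd b
        have h0 : 0 ≤ ∑ p ∈ ({a | G.Adj b a} : Finset V).offDiag, g p.1 ^ 3 * g p.2 ^ 3 :=
          Finset.sum_nonneg fun p _ => mul_nonneg (pow_nonneg (hg _) 3) (pow_nonneg (hg _) 3)
        gcongr
    _ = 4 * ∑ b, ∑ a ∈ {a | G.Adj b a}, g a ^ 6 + 8 * d *
          ∑ b, ∑ p ∈ ({a | G.Adj b a} : Finset V).offDiag, g p.1 ^ 3 * g p.2 ^ 3 := by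
        rw [Finset.sum_add_distrib, Finset.mul_sum, Finset.mul_sum]
    _ ≤ 4 * (d * (∑ a, g a ^ 3) ^ 2) + 8 * d * (2 * (∑ a, g a ^ 3) ^ 2) := by
        have hD' := hD.trans (mul_le_mul_of_nonneg_left h6 (Nat.cast_nonneg d))
        gcongr
    _ = _ := by ring

/-- Hölder with exponents 3/2 and 3, cubed so that only integer powers remain. -/
lemma sum_sq_mul_pow_three_le {ι : Type*} (s : Finset ι) (k H : ι → ℝ) (hk : ∀ i, 0 ≤ k i)
    (hH : ∀ i, 0 ≤ H i) :
    (∑ i ∈ s, k i ^ 2 * H i) ^ 3 ≤ (∑ i ∈ s, k i ^ 3) ^ 2 * ∑ i ∈ s, H i ^ 3 := by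
  have h := Real.inner_le_Lp_mul_Lq_of_nonneg s (p := 3 / 2) (q := 3)
    (by constructor <;> norm_num) (f := fun i => k i ^ 2) (g := H)
    (fun i _ => by positivity) (fun i _ => hH i)
  have e1 : ∀ i, (k i ^ 2) ^ (3 / 2 : ℝ) = k i ^ 3 := fun i => by
    rw [← Real.rpow_natCast, ← Real.rpow_mul (hk i), ← Real.rpow_natCast]; norm_num
  have e2 : ∀ i, H i ^ (3 : ℝ) = H i ^ 3 := fun i => by
    rw [← Real.rpow_natCast]; norm_num
  simp only [e1, e2] at h
  have h0 : 0 ≤ ∑ i ∈ s, k i ^ 2 * H i :=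
    Finset.sum_nonneg fun i _ => mul_nonneg (sq_nonneg _) (hH i)
  have hA : 0 ≤ ∑ i ∈ s, k i ^ 3 := Finset.sum_nonneg fun i _ => pow_nonneg (hk i) 3
  have hB : 0 ≤ ∑ i ∈ s, H i ^ 3 := Finset.sum_nonneg fun i _ => pow_nonneg (hH i) 3
  refine (pow_le_pow_left₀ h0 h 3).trans_eq ?_
  rw [mul_pow, ← Real.rpow_natCast, ← Real.rpow_natCast (_ ^ _), ← Real.rpow_mul hA,
    ← Real.rpow_mul hB, ← Real.rpow_natCast]
  norm_num

/-- The estimate at the exponents `(3/2, 3/2, ∞)`. -/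
lemma sum_triangles_sq_mul_sq_pow_three_le (hG : CodegreeLeTwo G) {d : ℕ}
    (hd : ∀ a, #{b | G.Adj a b} ≤ d) (g k : V → ℝ) (hg : ∀ a, 0 ≤ g a) (hk : ∀ a, 0 ≤ k a) :
    (∑ x ∈ triangles G, g x.1 ^ 2 * k x.2.1 ^ 2) ^ 3 ≤
      160 * d * ((∑ a, g a ^ 3) ^ 2 * (∑ a, k a ^ 3) ^ 2) := by
  have h1 := sum_triangles_edge_le hG (fun a b => g a ^ 2 * k b ^ 2)
    (fun a b => mul_nonneg (sq_nonneg _) (sq_nonneg _))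
  have e : ∑ b, ∑ a ∈ {a | G.Adj b a}, g a ^ 2 * k b ^ 2 =
      ∑ b, k b ^ 2 * ∑ a ∈ {a | G.Adj b a}, g a ^ 2 :=
    Finset.sum_congr rfl fun b _ => by rw [← Finset.sum_mul, mul_comm]
  rw [e] at h1
  have h2 := sum_sq_mul_pow_three_le Finset.univ k
    (fun b => ∑ a ∈ {a | G.Adj b a}, g a ^ 2) hk
    (fun b => Finset.sum_nonneg fun a _ => sq_nonneg _)
  have h3 := mul_le_mul_of_nonneg_left (sum_neighbor_pow_three_le hG hd g hg)
    (sq_nonneg (∑ a, k a ^ 3))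
  have h0 : 0 ≤ ∑ x ∈ triangles G, g x.1 ^ 2 * k x.2.1 ^ 2 :=
    Finset.sum_nonneg fun x _ => mul_nonneg (sq_nonneg _) (sq_nonneg _)
  have h4 := pow_le_pow_left₀ h0 h1 3
  rw [mul_pow] at h4
  linarith

end Graph

/-! ### Symmetries, pairs of triangles and the estimate at (2, 2, 2) -/

section Graph

open Finset

variable {V : Type*} [Fintype V] {G : SimpleGraph V} [DecidableRel G.Adj]

lemma sum_triangles_swap (f₁ f₂ f₃ : V → ℝ) :
    ∑ x ∈ triangles G, f₂ x.1 * f₁ x.2.1 * f₃ x.2.2 =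
      ∑ x ∈ triangles G, f₁ x.1 * f₂ x.2.1 * f₃ x.2.2 := by
  refine Finset.sum_nbij' (fun x => (x.2.1, x.1, x.2.2)) (fun x => (x.2.1, x.1, x.2.2))
    ?_ ?_ (fun _ _ => rfl) (fun _ _ => rfl) (fun x _ => by ring)
  all_goals
    intro x hx
    simp only [triangles, Finset.mem_filter, Finset.mem_univ, true_and] at hx ⊢
    exact ⟨hx.1.symm, hx.2.2.symm, hx.2.1.symm⟩

lemma sum_triangles_rotate (f₁ f₂ f₃ : V → ℝ) :
    ∑ x ∈ triangles G, f₂ x.1 * f₃ x.2.1 * f₁ x.2.2 =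
      ∑ x ∈ triangles G, f₁ x.1 * f₂ x.2.1 * f₃ x.2.2 := by
  refine Finset.sum_nbij' (fun x => (x.2.2, x.1, x.2.1)) (fun x => (x.2.1, x.2.2, x.1))
    ?_ ?_ (fun _ _ => rfl) (fun _ _ => rfl) (fun x _ => by ring)
  all_goals
    intro x hx
    simp only [triangles, Finset.mem_filter, Finset.mem_univ, true_and] at hx ⊢
    tauto

variable [DecidableEq V]

/-- Two triangles `a b c` and `a' b c'` with a common vertex `b`, stored as
`(b, (a, c), (a', c'))`. -/
def trianglePairs (G : SimpleGraph V) [DecidableRel G.Adj] : Finset (V × (V × V) × (V × V)) :=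
  {y | (y.2.1.1, y.1, y.2.1.2) ∈ triangles G ∧ (y.2.2.1, y.1, y.2.2.2) ∈ triangles G}

/-- The pairs of triangles `a b c`, `a' b c'` with `a ≠ c'` and `a' ≠ c`. -/
def crossPairs (G : SimpleGraph V) [DecidableRel G.Adj] : Finset (V × (V × V) × (V × V)) :=
  {y ∈ trianglePairs G | y.2.1.1 ≠ y.2.2.2 ∧ y.2.2.1 ≠ y.2.1.2}

/-- The pairs of triangles `a b c`, `a' b c'` with `a = c'` or `a' = c`. -/
def chainPairs (G : SimpleGraph V) [DecidableRel G.Adj] : Finset (V × (V × V) × (V × V)) :=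
  {y ∈ trianglePairs G | ¬ (y.2.1.1 ≠ y.2.2.2 ∧ y.2.2.1 ≠ y.2.1.2)}

lemma mem_trianglePairs {b a c a' c' : V} : (b, (a, c), (a', c')) ∈ trianglePairs G ↔
    (G.Adj a b ∧ G.Adj b c ∧ G.Adj c a) ∧ G.Adj a' b ∧ G.Adj b c' ∧ G.Adj c' a' := by
  simp [trianglePairs, triangles]

/-- Once the distinct vertices a and c' are fixed, b is one of their at most two common neighbours;
then c completes the edge ab and a' the edge bc', in at most two ways each. -/
lemma sum_crossPairs_le (hG : CodegreeLeTwo G) (φ : V × V → ℝ) (hφ : ∀ y, 0 ≤ φ y) :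
    ∑ y ∈ crossPairs G, φ (y.2.1.1, y.2.2.2) ≤ 8 * ∑ y, φ y := by
  refine (sum_comp_le_mul_sum (crossPairs G)
    (fun y => (y.2.1.1, y.2.2.2)) 8 (fun z => ?_) φ hφ).trans_eq (by norm_num)
  obtain ⟨p, r⟩ := z
  by_cases hpr : p = r
  · rw [Finset.filter_eq_empty_iff.2]
    · simp
    · rintro ⟨b, ⟨a, c⟩, a', c'⟩ hy e
      simp only [Prod.mk.injEq] at e
      have := (Finset.mem_filter.1 hy).2.1
      simp [e.1, e.2, hpr] at this
  have key := card_le_mul_of_fiber (m := 2) (n := 4)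
    ({y ∈ crossPairs G | (y.2.1.1, y.2.2.2) = (p, r)}.image
      fun y => (y.1, y.2.1.2, y.2.2.1))
    {b | G.Adj p b ∧ G.Adj r b}
    (fun b => ({c | G.Adj p c ∧ G.Adj b c} : Finset V) ×ˢ ({a | G.Adj r a ∧ G.Adj b a} : Finset V))
    (hG p r hpr) (fun b hb => by
      simp only [Finset.mem_filter, Finset.mem_univ, true_and] at hb
      rw [Finset.card_product]
      exact Nat.mul_le_mul (hG p b hb.1.ne) (hG r b hb.2.ne)) (by
      intro x hx
      obtain ⟨⟨b, ⟨a, c⟩, a', c'⟩, hy, rfl⟩ := Finset.mem_image.1 hx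
      simp only [crossPairs, Finset.mem_filter, mem_trianglePairs, Prod.mk.injEq] at hy
      obtain ⟨⟨⟨⟨h1, h2, h3⟩, h4, h5, h6⟩, -⟩, rfl, rfl⟩ := hy
      simp only [Finset.mem_filter, Finset.mem_univ, true_and, Finset.mem_product]
      exact ⟨⟨h1, h5.symm⟩, ⟨h3.symm, h2⟩, h6, h4.symm⟩)
  rwa [Finset.card_image_of_injOn] at key
  rintro ⟨b, ⟨a, c⟩, a', c'⟩ h1 ⟨b₁, ⟨a₁, c₁⟩, a₁', c₁'⟩ h2 e
  simp only [Finset.coe_filter, Set.mem_ofPred_eq, Prod.mk.injEq] at h1 h2 e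
  simp [h1.2, h2.2, e]

/-- Here a = c' is allowed, so the adjacent pair (a, c) is fixed instead: at most two b, and the
second triangle shares the edge ab or bc, with at most two third vertices in either case. -/
lemma sum_chainPairs_le (hG : CodegreeLeTwo G) (φ : V × V → ℝ) (hφ : ∀ y, 0 ≤ φ y) :
    ∑ y ∈ chainPairs G, φ y.2.1 ≤ 8 * ∑ y, φ y := by
  refine (sum_comp_le_mul_sum (chainPairs G)
    (fun y => y.2.1) 8 (fun z => ?_) φ hφ).trans_eq (by norm_num)
  obtain ⟨p, r⟩ := z
  by_cases hpr : p = r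
  · rw [Finset.filter_eq_empty_iff.2]
    · simp
    · rintro ⟨b, ⟨a, c⟩, a', c'⟩ hy e
      simp only [chainPairs, Finset.mem_filter, mem_trianglePairs, Prod.mk.injEq] at hy e
      exact hy.1.1.2.2.ne (by rw [e.1, e.2, hpr])
  have key := card_le_mul_of_fiber (m := 2) (n := 4)
    ({y ∈ chainPairs G | y.2.1 = (p, r)}.image fun y => (y.1, y.2.2))
    {b | G.Adj p b ∧ G.Adj r b}
    (fun b => (({a | G.Adj p a ∧ G.Adj b a} : Finset V) ×ˢ {p}) ∪
      ({r} ×ˢ ({c | G.Adj r c ∧ G.Adj b c} : Finset V)))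
    (hG p r hpr) (fun b hb => by
      simp only [Finset.mem_filter, Finset.mem_univ, true_and] at hb
      refine (Finset.card_union_le _ _).trans ?_
      rw [Finset.card_product, Finset.card_product, Finset.card_singleton, Finset.card_singleton,
        mul_one, one_mul]
      exact Nat.add_le_add (hG p b hb.1.ne) (hG r b hb.2.ne)) (by
      intro x hx
      obtain ⟨⟨b, ⟨a, c⟩, a', c'⟩, hy, rfl⟩ := Finset.mem_image.1 hx
      simp only [chainPairs, Finset.mem_filter, mem_trianglePairs, Prod.mk.injEq] at hy
      obtain ⟨⟨⟨⟨h1, h2, h3⟩, h4, h5, h6⟩, h7⟩, rfl, rfl⟩ := hy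
      simp only [Finset.mem_filter, Finset.mem_univ, true_and, Finset.mem_product,
        Finset.mem_union, Finset.mem_singleton]
      refine ⟨⟨h1, h2.symm⟩, ?_⟩
      by_cases h8 : a = c'
      · subst h8; exact Or.inl ⟨⟨h6, h4.symm⟩, rfl⟩
      · have h9 : a' = c := by by_contra h; exact h7 ⟨h8, h⟩
        subst h9; exact Or.inr ⟨rfl, h6.symm, h5⟩)
  rwa [Finset.card_image_of_injOn] at key
  rintro ⟨b, p, p'⟩ h1 ⟨b₁, p₁, p₁'⟩ h2 e
  simp only [Finset.coe_filter, Set.mem_ofPred_eq, Prod.mk.injEq] at h1 h2 e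
  simp [h1.2, h2.2, e]

lemma sum_crossPairs_swap (φ : V × V → ℝ) :
    ∑ y ∈ crossPairs G, φ (y.2.2.1, y.2.1.2) = ∑ y ∈ crossPairs G, φ (y.2.1.1, y.2.2.2) := by
  refine Finset.sum_nbij' (fun y => (y.1, y.2.2, y.2.1)) (fun y => (y.1, y.2.2, y.2.1))
    ?_ ?_ ?_ ?_ ?_
  all_goals rintro ⟨b, ⟨a, c⟩, a', c'⟩ h
  all_goals simp only [crossPairs, Finset.mem_filter, mem_trianglePairs] at h ⊢
  all_goals tauto

lemma sum_chainPairs_swap (φ : V × V → ℝ) :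
    ∑ y ∈ chainPairs G, φ y.2.2 = ∑ y ∈ chainPairs G, φ y.2.1 := by
  refine Finset.sum_nbij' (fun y => (y.1, y.2.2, y.2.1)) (fun y => (y.1, y.2.2, y.2.1))
    ?_ ?_ ?_ ?_ ?_
  all_goals rintro ⟨b, ⟨a, c⟩, a', c'⟩ h
  all_goals simp only [chainPairs, Finset.mem_filter, mem_trianglePairs] at h ⊢
  all_goals tauto

/-- The strong-type estimate at the exponents `(2, 2, 2)`. -/
lemma sum_triangles_mul_sq_le (hG : CodegreeLeTwo G) (f₁ f₂ f₃ : V → ℝ) :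
    (∑ x ∈ triangles G, f₁ x.1 * f₂ x.2.1 * f₃ x.2.2) ^ 2 ≤
      16 * ((∑ a, f₁ a ^ 2) * (∑ a, f₂ a ^ 2) * (∑ a, f₃ a ^ 2)) := by
  set P : V → Finset (V × V) := fun b => {p | (p.1, b, p.2) ∈ triangles G} with hP
  set φ : V × V → ℝ := fun p => f₁ p.1 ^ 2 * f₃ p.2 ^ 2 with hφ
  have hφ0 : ∀ p, 0 ≤ φ p := fun p => mul_nonneg (sq_nonneg _) (sq_nonneg _)
  have hS : ∑ p, φ p = (∑ a, f₁ a ^ 2) * ∑ a, f₃ a ^ 2 := by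
    rw [Finset.sum_mul_sum, Fintype.sum_prod_type]
  -- Isolate the middle vertex b, for Cauchy–Schwarz in b.
  have e1 : ∑ x ∈ triangles G, f₁ x.1 * f₂ x.2.1 * f₃ x.2.2 =
      ∑ b, f₂ b * ∑ p ∈ P b, f₁ p.1 * f₃ p.2 := by
    rw [← Finset.univ_inter (triangles G), ← Finset.sum_ite_mem, Fintype.sum_prod_type]
    simp only [Fintype.sum_prod_type, hP, Finset.mul_sum, Finset.sum_filter]
    rw [Finset.sum_comm]
    refine Finset.sum_congr rfl fun b _ => Finset.sum_congr rfl fun a _ =>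
      Finset.sum_congr rfl fun c _ => ?_
    split_ifs <;> ring
  have e2 : ∑ b, (∑ p ∈ P b, f₁ p.1 * f₃ p.2) ^ 2 = ∑ y ∈ trianglePairs G,
      (f₁ y.2.1.1 * f₃ y.2.1.2) * (f₁ y.2.2.1 * f₃ y.2.2.2) := by
    rw [trianglePairs, Finset.sum_filter, Fintype.sum_prod_type]
    refine Finset.sum_congr rfl fun b _ => ?_
    rw [sq, Finset.sum_mul_sum, ← Finset.sum_product', ← Finset.sum_filter]
    refine Finset.sum_congr ?_ fun _ _ => rfl
    ext p; simp [hP]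
  have c1 := sum_crossPairs_le hG φ hφ0
  have c2 := (sum_crossPairs_swap (G := G) φ).trans_le c1
  have c3 := sum_chainPairs_le hG φ hφ0
  have c4 := (sum_chainPairs_swap (G := G) φ).trans_le c3
  have e3 : ∑ b, (∑ p ∈ P b, f₁ p.1 * f₃ p.2) ^ 2 ≤ 16 * ∑ p, φ p := by
    rw [e2, ← Finset.sum_filter_add_sum_filter_not (trianglePairs G)
      (fun y => y.2.1.1 ≠ y.2.2.2 ∧ y.2.2.1 ≠ y.2.1.2)]
    -- The four factors are paired across the triangles, (a, c') with (a', c), before AM–GM; on the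
    -- chain pairs they are paired within each triangle.
    have d1 : ∑ y ∈ crossPairs G, (f₁ y.2.1.1 * f₃ y.2.1.2) * (f₁ y.2.2.1 * f₃ y.2.2.2) ≤
        (∑ y ∈ crossPairs G, φ (y.2.1.1, y.2.2.2) +
          ∑ y ∈ crossPairs G, φ (y.2.2.1, y.2.1.2)) / 2 := by
      rw [← Finset.sum_add_distrib, Finset.sum_div]
      refine Finset.sum_le_sum fun y _ => ?_
      simp only [hφ]
      linarith [two_mul_le_add_sq (f₁ y.2.1.1 * f₃ y.2.2.2) (f₁ y.2.2.1 * f₃ y.2.1.2)]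
    have d2 : ∑ y ∈ chainPairs G, (f₁ y.2.1.1 * f₃ y.2.1.2) * (f₁ y.2.2.1 * f₃ y.2.2.2) ≤
        (∑ y ∈ chainPairs G, φ y.2.1 + ∑ y ∈ chainPairs G, φ y.2.2) / 2 := by
      rw [← Finset.sum_add_distrib, Finset.sum_div]
      refine Finset.sum_le_sum fun y _ => ?_
      simp only [hφ]
      linarith [two_mul_le_add_sq (f₁ y.2.1.1 * f₃ y.2.1.2) (f₁ y.2.2.1 * f₃ y.2.2.2)]
    unfold crossPairs at d1 c1 c2
    unfold chainPairs at d2 c3 c4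
    linarith
  rw [e1]
  refine (Finset.sum_mul_sq_le_sq_mul_sq _ _ _).trans ?_
  rw [hS] at e3
  refine (mul_le_mul_of_nonneg_left e3 (Finset.sum_nonneg fun a _ => sq_nonneg _)).trans_eq ?_
  ring

/-! ### Combining the vertex estimates -/

/-- The estimate for normalized densities, with the exponents in decreasing order. -/
lemma sum_triangles_rpow_le (hG : CodegreeLeTwo G) {q : ℕ} (hd : ∀ a, #{b | G.Adj a b} ≤ 2 * q)
    (hV : Fintype.card V = q ^ 2) (g₁ g₂ g₃ : V → ℝ) (h₁ : ∀ a, 0 ≤ g₁ a) (h₂ : ∀ a, 0 ≤ g₂ a)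
    (h₃ : ∀ a, 0 ≤ g₃ a) (s₁ : ∑ a, g₁ a ≤ q ^ 2) (s₂ : ∑ a, g₂ a ≤ q ^ 2)
    (s₃ : ∑ a, g₃ a ≤ q ^ 2) {u₁ u₂ u₃ : ℝ} (h0 : 0 ≤ u₃) (h32 : u₃ ≤ u₂) (h21 : u₂ ≤ u₁)
    (hu : 2 * u₁ + u₂ + u₃ ≤ 2) :
    ∑ x ∈ triangles G, g₁ x.1 ^ u₁ * g₂ x.2.1 ^ u₂ * g₃ x.2.2 ^ u₃ ≤ 7 * q ^ 3 := by
  have hq : (0 : ℝ) ≤ q := Nat.cast_nonneg q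
  have n₁ : 0 ≤ ∑ a, g₁ a := Finset.sum_nonneg fun a _ => h₁ a
  have n₂ : 0 ≤ ∑ a, g₂ a := Finset.sum_nonneg fun a _ => h₂ a
  have n₃ : 0 ≤ ∑ a, g₃ a := Finset.sum_nonneg fun a _ => h₃ a
  have b1 : ∑ x ∈ triangles G, √(g₁ x.1) * √(g₂ x.2.1) * √(g₃ x.2.2) ≤ 7 * q ^ 3 := by
    have h := sum_triangles_mul_sq_le hG (fun a => √(g₁ a)) (fun a => √(g₂ a)) (fun a => √(g₃ a))
    simp only [Real.sq_sqrt (h₁ _), Real.sq_sqrt (h₂ _), Real.sq_sqrt (h₃ _)] at h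
    refine le_of_sq_le_sq (h.trans ?_) (by positivity)
    calc 16 * ((∑ a, g₁ a) * (∑ a, g₂ a) * (∑ a, g₃ a))
        ≤ 16 * ((q : ℝ) ^ 2 * q ^ 2 * q ^ 2) := by gcongr
      _ ≤ (7 * (q : ℝ) ^ 3) ^ 2 := by nlinarith [pow_nonneg hq 6]
  have cr : ∀ {z : ℝ}, 0 ≤ z → (z ^ (1 / 3 : ℝ)) ^ 3 = z := fun hz => by
    rw [← Real.rpow_natCast, ← Real.rpow_mul hz]; norm_num
  have b2 : ∑ x ∈ triangles G, (g₁ x.1 ^ (1 / 3 : ℝ)) ^ 2 * (g₂ x.2.1 ^ (1 / 3 : ℝ)) ^ 2 ≤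
      7 * q ^ 3 := by
    have h := sum_triangles_sq_mul_sq_pow_three_le hG hd (fun a => g₁ a ^ (1 / 3 : ℝ))
      (fun a => g₂ a ^ (1 / 3 : ℝ)) (fun a => Real.rpow_nonneg (h₁ a) _)
      (fun a => Real.rpow_nonneg (h₂ a) _)
    simp only [cr (h₁ _), cr (h₂ _)] at h
    refine le_of_pow_le_pow_left₀ three_ne_zero (by positivity) (h.trans ?_)
    push_cast
    calc (160 : ℝ) * (2 * (q : ℝ)) * ((∑ a, g₁ a) ^ 2 * (∑ a, g₂ a) ^ 2)
        ≤ (160 : ℝ) * (2 * (q : ℝ)) * (((q : ℝ) ^ 2) ^ 2 * ((q : ℝ) ^ 2) ^ 2) := by gcongr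
      -- This vertex dictates the constant 7: 160 · 2 = 320 ≤ 7³.
      _ ≤ (7 * (q : ℝ) ^ 3) ^ 3 := by nlinarith [pow_nonneg hq 9]
  have b3 : ∑ x ∈ triangles G, g₁ x.1 ≤ 7 * q ^ 3 := by
    refine (sum_triangles_fst_le hG hd g₁ h₁).trans ?_
    push_cast
    calc 2 * (q : ℝ) * 2 * ∑ a, g₁ a ≤ 2 * (q : ℝ) * 2 * q ^ 2 := by gcongr
      _ ≤ 7 * q ^ 3 := by nlinarith [pow_nonneg hq 3]
  have b4 : ∑ x ∈ triangles G, (1 : ℝ) ≤ 7 * q ^ 3 := by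
    refine (sum_triangles_fst_le hG hd (fun _ => 1) fun _ => zero_le_one).trans ?_
    simp only [Finset.sum_const, Finset.card_univ, hV, nsmul_eq_mul]
    push_cast
    nlinarith [pow_nonneg hq 3]
  -- Barycentric coordinates of (u₁, u₂, u₃) with respect to (1/2,1/2,1/2), (2/3,2/3,0), (1,0,0) and
  -- (0,0,0).
  set w₁ := 2 * u₃
  set w₂ := 3 / 2 * (u₂ - u₃)
  set w₃ := u₁ - u₂
  set w₄ := 1 - (u₁ + u₂ / 2 + u₃ / 2)
  have k1 : 0 ≤ w₁ := by simp only [w₁]; linarith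
  have k2 : 0 ≤ w₂ := by simp only [w₂]; linarith
  have k3 : 0 ≤ w₃ := by simp only [w₃]; linarith
  have k4 : 0 ≤ w₄ := by simp only [w₄]; linarith
  have ks : w₁ + w₂ + w₃ + w₄ = 1 := by simp only [w₁, w₂, w₃, w₄]; ring
  have pt : ∀ x y z : ℝ, 0 ≤ x → 0 ≤ y → 0 ≤ z → x ^ u₁ * y ^ u₂ * z ^ u₃ ≤
      w₁ * (√x * √y * √z) + w₂ * ((x ^ (1 / 3 : ℝ)) ^ 2 * (y ^ (1 / 3 : ℝ)) ^ 2) + w₃ * x +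
        w₄ * 1 := by
    intro x y z hx hy hz
    refine le_trans (le_of_eq ?_) (Real.geom_mean_le_arith_mean4_weighted k1 k2 k3 k4
      (by positivity) (by positivity) hx zero_le_one ks)
    rw [Real.one_rpow, mul_one, Real.mul_rpow (by positivity) (by positivity),
      Real.mul_rpow (by positivity) (by positivity), Real.mul_rpow (by positivity) (by positivity)]
    simp only [Real.sqrt_eq_rpow, ← Real.rpow_natCast, ← Real.rpow_mul hx, ← Real.rpow_mul hy,
      ← Real.rpow_mul hz]
    have hx' : x ^ u₁ = x ^ (1 / 2 * w₁) * x ^ (1 / 3 * ((2 : ℕ) : ℝ) * w₂) * x ^ w₃ := by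
      rw [← Real.rpow_add_of_nonneg hx (by positivity) (by positivity),
        ← Real.rpow_add_of_nonneg hx (by positivity) (by positivity)]
      congr 1; simp only [w₁, w₂, w₃]; push_cast; ring
    have hy' : y ^ u₂ = y ^ (1 / 2 * w₁) * y ^ (1 / 3 * ((2 : ℕ) : ℝ) * w₂) := by
      rw [← Real.rpow_add_of_nonneg hy (by positivity) (by positivity)]
      congr 1; simp only [w₁, w₂]; push_cast; ring
    have hz' : z ^ u₃ = z ^ (1 / 2 * w₁) := by
      congr 1; simp only [w₁]; ring
    rw [hx', hy', hz']; ring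
  calc ∑ x ∈ triangles G, g₁ x.1 ^ u₁ * g₂ x.2.1 ^ u₂ * g₃ x.2.2 ^ u₃
      ≤ ∑ x ∈ triangles G, (w₁ * (√(g₁ x.1) * √(g₂ x.2.1) * √(g₃ x.2.2)) +
          w₂ * ((g₁ x.1 ^ (1 / 3 : ℝ)) ^ 2 * (g₂ x.2.1 ^ (1 / 3 : ℝ)) ^ 2) + w₃ * g₁ x.1 +
          w₄ * 1) := Finset.sum_le_sum fun x _ => pt _ _ _ (h₁ _) (h₂ _) (h₃ _)
    _ ≤ w₁ * (7 * q ^ 3) + w₂ * (7 * q ^ 3) + w₃ * (7 * q ^ 3) + w₄ * (7 * q ^ 3) := by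
        simp only [Finset.sum_add_distrib, ← Finset.mul_sum]
        gcongr
    _ = (w₁ + w₂ + w₃ + w₄) * (7 * q ^ 3) := by ring
    _ = 7 * q ^ 3 := by rw [ks, one_mul]

/-- The estimate for normalized densities, with the exponents in any order. -/
lemma sum_triangles_rpow_le_of_exponents (hG : CodegreeLeTwo G) {q : ℕ}
    (hd : ∀ a, #{b | G.Adj a b} ≤ 2 * q)
    (hV : Fintype.card V = q ^ 2) (g₁ g₂ g₃ : V → ℝ) (h₁ : ∀ a, 0 ≤ g₁ a) (h₂ : ∀ a, 0 ≤ g₂ a)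
    (h₃ : ∀ a, 0 ≤ g₃ a) (s₁ : ∑ a, g₁ a ≤ q ^ 2) (s₂ : ∑ a, g₂ a ≤ q ^ 2)
    (s₃ : ∑ a, g₃ a ≤ q ^ 2) {u₁ u₂ u₃ : ℝ} (p₁ : 0 ≤ u₁) (p₂ : 0 ≤ u₂) (p₃ : 0 ≤ u₃)
    (e₁ : 2 * u₁ + u₂ + u₃ ≤ 2) (e₂ : u₁ + 2 * u₂ + u₃ ≤ 2) (e₃ : u₁ + u₂ + 2 * u₃ ≤ 2) :
    ∑ x ∈ triangles G, g₁ x.1 ^ u₁ * g₂ x.2.1 ^ u₂ * g₃ x.2.2 ^ u₃ ≤ 7 * q ^ 3 := by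
  have S := sum_triangles_swap (G := G)
  have R := sum_triangles_rotate (G := G)
  have W := @sum_triangles_rpow_le V _ G _ _ hG q hd hV
  set f₁ := fun a => g₁ a ^ u₁
  set f₂ := fun a => g₂ a ^ u₂
  set f₃ := fun a => g₃ a ^ u₃
  -- Of the eight sign patterns, the two cyclic ones force equality of all three exponents, so any
  -- order serves there.
  rcases le_total u₂ u₁ with a | a <;> rcases le_total u₃ u₂ with b | b <;>
    rcases le_total u₃ u₁ with c | c
  · exact W g₁ g₂ g₃ h₁ h₂ h₃ s₁ s₂ s₃ p₃ b a e₁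
  · exact W g₁ g₂ g₃ h₁ h₂ h₃ s₁ s₂ s₃ p₃ b a e₁
  · exact ((S f₃ f₁ f₂).trans ((R f₂ f₃ f₁).trans (R f₁ f₂ f₃))).ge.trans
      (W g₁ g₃ g₂ h₁ h₃ h₂ s₁ s₃ s₂ p₂ b c (by linarith))
  · exact ((R f₂ f₃ f₁).trans (R f₁ f₂ f₃)).ge.trans
      (W g₃ g₁ g₂ h₃ h₁ h₂ s₃ s₁ s₂ p₂ a c (by linarith))
  · exact (S f₁ f₂ f₃).ge.trans (W g₂ g₁ g₃ h₂ h₁ h₃ s₂ s₁ s₃ p₃ c a (by linarith))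
  · exact (R f₁ f₂ f₃).ge.trans (W g₂ g₃ g₁ h₂ h₃ h₁ s₂ s₃ s₁ p₁ c b (by linarith))
  · exact (S f₁ f₂ f₃).ge.trans (W g₂ g₁ g₃ h₂ h₁ h₃ s₂ s₁ s₃ p₃ c a (by linarith))
  · exact ((S f₂ f₃ f₁).trans (R f₁ f₂ f₃)).ge.trans
      (W g₃ g₂ g₁ h₃ h₂ h₁ s₃ s₂ s₁ p₁ a b (by linarith))

end Graph
-- Circles over a finite field
section Circle

open Finset
open scoped Classical

variable {F : Type}

lemma card_plane [Fintype F] : Fintype.card (Plane F) = Fintype.card F ^ 2 := by simp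

variable [Field F]

lemma mem_circle {t : F} {x : Plane F} : x ∈ circle t ↔ x 0 ^ 2 + x 1 ^ 2 = t := Iff.rfl

lemma neg_mem_circle {t : F} {x : Plane F} (h : x ∈ circle t) : -x ∈ circle t := by
  simpa [circle] using h

/-- Two points of the plane are adjacent when their difference lies on the circle. -/
def circleGraph {t : F} (ht : t ≠ 0) : SimpleGraph (Plane F) where
  Adj a b := a - b ∈ circle t
  symm := ⟨fun a b h => by rw [← neg_sub]; exact neg_mem_circle h⟩
  loopless := ⟨fun a h => ht (by simpa [circle] using h.symm)⟩

lemma circleGraph_adj {t : F} (ht : t ≠ 0) (a b : Plane F) :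
    (circleGraph ht).Adj a b ↔ a - b ∈ circle t := Iff.rfl

/-- Every chord from the centre extends to an equilateral triangle by a rotation of order six. -/
lemma exists_rotation (h2 : (2 : F) ≠ 0) (h3 : IsSquare (3 : F)) : ∃ R : Plane F → Plane F,
    ∀ (t : F) (x : Plane F), x ∈ circle t → R x ∈ circle t ∧ x - R x ∈ circle t := by
  obtain ⟨r, hr⟩ := h3
  -- Rotation with cosine 1/2 and sine r/2, where r² = 3.
  refine ⟨fun x => ![(x 0 - r * x 1) / 2, (r * x 0 + x 1) / 2], fun t x hx => ?_⟩
  simp only [circle, Set.mem_ofPred_eq, Pi.sub_apply, Matrix.cons_val_zero,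
    Matrix.cons_val_one] at hx ⊢
  constructor <;> field_simp <;> linear_combination 4 * hx - (x 0 ^ 2 + x 1 ^ 2) * hr

variable [Fintype F]

lemma card_sq_eq_le_two (s : F) : #{y : F | y ^ 2 = s} ≤ 2 := by
  by_contra! h
  obtain ⟨a, ha, b, hb, c, hc, hab, hac, hbc⟩ := Finset.two_lt_card.1 h
  simp only [Finset.mem_filter, Finset.mem_univ, true_and] at ha hb hc
  have h1 := (sq_eq_sq_iff_eq_or_eq_neg.1 (ha.trans hb.symm)).resolve_left hab
  have h2 := (sq_eq_sq_iff_eq_or_eq_neg.1 (ha.trans hc.symm)).resolve_left hac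
  exact hbc (neg_injective (h1.symm.trans h2))

lemma ncard_circle (t : F) : (circle t).ncard = #{x : Plane F | x ∈ circle t} := by
  rw [← Set.ncard_coe_finset]; congr 1; ext x; simp

lemma ncard_circle_le (t : F) : (circle t).ncard ≤ 2 * Fintype.card F := by
  rw [ncard_circle]
  have key := card_le_mul_of_fiber
    (({x : Plane F | x ∈ circle t} : Finset (Plane F)).image fun x => (x 0, x 1))
    Finset.univ (fun a => {y | y ^ 2 = t - a ^ 2}) le_rfl (fun a _ => card_sq_eq_le_two _) (by
      intro y hy
      obtain ⟨x, hx, rfl⟩ := Finset.mem_image.1 hy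
      simp only [Finset.mem_filter, Finset.mem_univ, true_and] at hx ⊢
      rw [mem_circle] at hx
      rw [← hx]; ring)
  rwa [Finset.card_image_of_injective, Finset.card_univ, mul_comm] at key
  intro x y h
  simp only [Prod.mk.injEq] at h
  ext i; fin_cases i
  exacts [h.1, h.2]

lemma odd_card (h2 : (2 : F) ≠ 0) : Fintype.card F % 2 = 1 := by
  refine FiniteField.odd_card_of_char_ne_two fun h => h2 ?_
  have := ringChar.spec F 2
  rw [h] at this
  exact_mod_cast this.2 dvd_rfl

lemma exists_mem_circle (h2 : (2 : F) ≠ 0) (t : F) : ∃ x, x ∈ circle t := by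
  open Polynomial in
  obtain ⟨a, b, h⟩ := FiniteField.exists_root_sum_quadratic (f := (X ^ 2 : F[X]))
    (g := X ^ 2 - C t) (by simp) (Polynomial.degree_X_pow_sub_C two_pos t) (odd_card h2)
  refine ⟨![a, b], ?_⟩
  simp only [Polynomial.eval_pow, Polynomial.eval_X, Polynomial.eval_sub, Polynomial.eval_C] at h
  simp only [circle, Set.mem_ofPred_eq, Matrix.cons_val_zero, Matrix.cons_val_one]
  linear_combination h

/-- Stereographic projection bounds the size of a circle from below. -/
lemma card_le_ncard_circle_add (h2 : (2 : F) ≠ 0) {t : F} (ht : t ≠ 0) :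
    Fintype.card F ≤ (circle t).ncard + 3 := by
  obtain ⟨p, hp⟩ := exists_mem_circle h2 t
  simp only [circle, Set.mem_ofPred_eq] at hp
  -- The line of slope m through p meets the circle again at parameter s m. The excluded slopes are
  -- the isotropic ones, at most two, and the tangent one, at most one.
  set M : Finset F := {m | 1 + m ^ 2 ≠ 0 ∧ p 0 + p 1 * m ≠ 0} with hM
  set s : F → F := fun m => -2 * (p 0 + p 1 * m) / (1 + m ^ 2) with hs
  have h1 : #M ≤ (circle t).ncard := by
    rw [ncard_circle]
    refine Finset.card_le_card_of_injOn (fun m => ![p 0 + s m, p 1 + s m * m]) ?_ ?_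
    · intro m hm
      simp only [hM, Finset.coe_filter, Finset.mem_univ, true_and, Set.mem_ofPred_eq] at hm
      simp only [Finset.coe_filter, Finset.mem_univ, true_and, Set.mem_ofPred_eq]
      simp only [mem_circle, Matrix.cons_val_zero, Matrix.cons_val_one]
      have e : s m * (1 + m ^ 2) = -2 * (p 0 + p 1 * m) := div_mul_cancel₀ _ hm.1
      linear_combination hp + s m * e
    · intro m hm n hn e
      simp only [hM, Finset.coe_filter, Finset.mem_univ, true_and, Set.mem_ofPred_eq] at hm hn
      have e0 := congrFun e 0
      have e1 := congrFun e 1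
      simp only [Matrix.cons_val_zero, Matrix.cons_val_one, add_right_inj] at e0 e1
      rw [← e0] at e1
      exact mul_left_cancel₀ (div_ne_zero (mul_ne_zero (neg_ne_zero.2 h2) hm.2) hm.1) e1
  have h3 : #{m : F | p 0 + p 1 * m = 0} ≤ 1 := by
    refine Finset.card_le_one.2 fun m hm n hn => ?_
    simp only [Finset.mem_filter, Finset.mem_univ, true_and] at hm hn
    by_contra hmn
    have e1 : p 1 = 0 := by
      have : p 1 * (m - n) = 0 := by linear_combination hm - hn
      exact (mul_eq_zero.1 this).resolve_right (sub_ne_zero.2 hmn)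
    have e0 : p 0 = 0 := by simpa [e1] using hm
    exact ht (by rw [← hp, e0, e1]; ring)
  have h4 : (Finset.univ : Finset F) ⊆
      M ∪ (({m | m ^ 2 = -1} : Finset F) ∪ ({m | p 0 + p 1 * m = 0} : Finset F)) := by
    intro m _
    simp only [hM, Finset.mem_union, Finset.mem_filter, Finset.mem_univ, true_and]
    by_cases a : 1 + m ^ 2 = 0
    · exact Or.inr (Or.inl (by linear_combination a))
    · by_cases b : p 0 + p 1 * m = 0
      · exact Or.inr (Or.inr b)
      · exact Or.inl ⟨a, b⟩
  have h5 := (Finset.card_le_card h4).trans (Finset.card_union_le _ _)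
  have h6 := Finset.card_union_le ({m : F | m ^ 2 = -1} : Finset F) {m | p 0 + p 1 * m = 0}
  have h7 := card_sq_eq_le_two (-1 : F)
  rw [Finset.card_univ] at h5
  omega

lemma ncard_circle_pos (h2 : (2 : F) ≠ 0) (t : F) : 0 < (circle t).ncard :=
  (Set.ncard_pos (Set.toFinite _)).2 (exists_mem_circle h2 t)

lemma card_le_four_mul_ncard_circle (h2 : (2 : F) ≠ 0) {t : F} (ht : t ≠ 0) :
    Fintype.card F ≤ 4 * (circle t).ncard := by
  have := card_le_ncard_circle_add h2 ht
  have := ncard_circle_pos h2 t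
  omega

lemma card_circleGraph_adj {t : F} (ht : t ≠ 0) (a : Plane F) :
    #{b | (circleGraph ht).Adj a b} = (circle t).ncard := by
  rw [ncard_circle]
  refine Finset.card_bij' (fun b _ => a - b) (fun b _ => a - b) ?_ ?_ ?_ ?_ <;>
    simp [circleGraph_adj]

/-- Two distinct circles of the same non-zero radius meet in at most two points. -/
lemma codegreeLeTwo_circleGraph (h2 : (2 : F) ≠ 0) {t : F} (ht : t ≠ 0) :
    CodegreeLeTwo (circleGraph ht) := by
  intro a b hab
  by_contra! h
  obtain ⟨x, hx, y, hy, z, hz, hxy, hxz, hyz⟩ := Finset.two_lt_card.1 h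
  simp only [Finset.mem_filter, Finset.mem_univ, true_and] at hx hy hz
  simp only [circleGraph_adj, mem_circle, Pi.sub_apply] at hx hy hz
  obtain ⟨x1, x2⟩ := hx
  obtain ⟨y1, y2⟩ := hy
  obtain ⟨z1, z2⟩ := hz
  set d0 := b 0 - a 0 with hd0
  set d1 := b 1 - a 1 with hd1
  have hd : d0 ≠ 0 ∨ d1 ≠ 0 := by
    by_contra! hc
    refine hab (funext fun i => ?_)
    fin_cases i
    exacts [(sub_eq_zero.1 hc.1).symm, (sub_eq_zero.1 hc.2).symm]
  -- Common neighbours x and w differ by a multiple l of the perpendicular (-d1, d0) of b - a; the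
  -- circle equation, divided by l ≠ 0, becomes linear in l.
  have par : ∀ w : Plane F, (a 0 - w 0) ^ 2 + (a 1 - w 1) ^ 2 = t →
      (b 0 - w 0) ^ 2 + (b 1 - w 1) ^ 2 = t → x ≠ w → ∃ l : F, l ≠ 0 ∧
        w 0 - x 0 = -(l * d1) ∧ w 1 - x 1 = l * d0 ∧
        2 * ((x 0 - a 0) * -d1 + (x 1 - a 1) * d0) + l * (d0 ^ 2 + d1 ^ 2) = 0 := by
    intro w w1 w2 hw
    have perp : (w 0 - x 0) * d0 + (w 1 - x 1) * d1 = 0 := by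
      refine mul_left_cancel₀ h2 ?_
      simp only [hd0, hd1]
      linear_combination w1 - w2 - x1 + x2
    have ⟨l, hl0, hl1⟩ : ∃ l : F, w 0 - x 0 = -(l * d1) ∧ w 1 - x 1 = l * d0 := by
      rcases hd with hd | hd
      · refine ⟨(w 1 - x 1) / d0, ?_, ?_⟩
        · field_simp; linear_combination perp
        · field_simp
      · refine ⟨-(w 0 - x 0) / d1, ?_, ?_⟩
        · field_simp
        · field_simp; linear_combination perp
    have hl : l ≠ 0 := by
      rintro rfl
      refine hw (funext fun i => ?_)
      fin_cases i
      · exact (sub_eq_zero.1 (by simpa using hl0)).symm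
      · exact (sub_eq_zero.1 (by simpa using hl1)).symm
    refine ⟨l, hl, hl0, hl1, mul_left_cancel₀ hl ?_⟩
    have e0 : w 0 = x 0 - l * d1 := by linear_combination hl0
    have e1 : w 1 = x 1 + l * d0 := by linear_combination hl1
    rw [e0, e1] at w1
    linear_combination w1 - x1
  obtain ⟨l, hl, l0, l1, hl2⟩ := par y y1 y2 hxy
  obtain ⟨m, hm, m0, m1, hm2⟩ := par z z1 z2 hxz
  have hlm : l ≠ m := by
    rintro rfl
    refine hyz (funext fun i => ?_)
    fin_cases i
    · exact sub_left_injective (l0.trans m0.symm)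
    · exact sub_left_injective (l1.trans m1.symm)
  -- Two distinct roots of one linear equation force b - a to be isotropic. Then x - a is parallel
  -- to it, hence isotropic as well, against t ≠ 0.
  have hN : d0 ^ 2 + d1 ^ 2 = 0 := by
    have : (l - m) * (d0 ^ 2 + d1 ^ 2) = 0 := by linear_combination hl2 - hm2
    exact (mul_eq_zero.1 this).resolve_left (sub_ne_zero.2 hlm)
  have k1 : (x 0 - a 0) * -d1 + (x 1 - a 1) * d0 = 0 := by
    refine mul_left_cancel₀ h2 ?_
    linear_combination hl2 - l * hN
  rcases hd with hd | hd
  · have : t * d0 ^ 2 = 0 := by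
      rw [← x1]
      linear_combination ((x 1 - a 1) * d0 + (x 0 - a 0) * d1) * k1 + (x 0 - a 0) ^ 2 * hN
    exact (mul_ne_zero ht (pow_ne_zero 2 hd)) this
  · have : t * d1 ^ 2 = 0 := by
      rw [← x1]
      linear_combination (-(x 0 - a 0) * d1 - (x 1 - a 1) * d0) * k1 + (x 1 - a 1) ^ 2 * hN
    exact (mul_ne_zero ht (pow_ne_zero 2 hd)) this

lemma form_eq_sum_triangles {t : F} (ht : t ≠ 0) (f₁ f₂ f₃ : Plane F → ℝ) :
    form t f₁ f₂ f₃ = 1 / ((Fintype.card F : ℝ) ^ 2 * ((circle t).ncard : ℝ)) *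
      ∑ x ∈ triangles (circleGraph ht), f₁ x.1 * f₂ x.2.1 * f₃ x.2.2 := by
  unfold form
  congr 1
  rw [triangles, Finset.sum_filter, Fintype.sum_prod_type]
  refine Finset.sum_congr rfl fun a _ => ?_
  rw [Fintype.sum_prod_type]
  refine Finset.sum_congr rfl fun b _ => Finset.sum_congr rfl fun c _ => ?_
  simp only [ind, Set.indicator_apply, circleGraph]
  split_ifs <;> simp_all

lemma form_swap {t : F} (ht : t ≠ 0) (f₁ f₂ f₃ : Plane F → ℝ) :
    form t f₂ f₁ f₃ = form t f₁ f₂ f₃ := by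
  rw [form_eq_sum_triangles ht, form_eq_sum_triangles ht, sum_triangles_swap]

lemma form_rotate {t : F} (ht : t ≠ 0) (f₁ f₂ f₃ : Plane F → ℝ) :
    form t f₂ f₃ f₁ = form t f₁ f₂ f₃ := by
  rw [form_eq_sum_triangles ht, form_eq_sum_triangles ht, sum_triangles_rotate]

/-! ### Normalized densities and the strong-type estimate -/

/-- Domination of a function by its norm times a power of a normalized density. -/
lemma exists_density (p : ℝ≥0∞) (hp : 1 ≤ p) (f : Plane F → ℝ) (hf : ∀ x, 0 ≤ f x) :
    ∃ g : Plane F → ℝ, (∀ x, 0 ≤ g x) ∧ ∑ x, g x ≤ (Fintype.card F : ℝ) ^ 2 ∧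
      ∀ x, f x ≤ lpNorm p f * g x ^ (p⁻¹).toReal := by
  by_cases h : p = ∞
  · refine ⟨fun _ => 1, fun _ => zero_le_one, ?_, fun x => ?_⟩
    · simp
    · simp only [lpNorm, h, if_true, Real.one_rpow, mul_one]
      exact (le_abs_self _).trans
        (le_ciSup (f := fun x => |f x|) (Set.finite_range _).bddAbove x)
  have hp0 : 0 < p.toReal := ENNReal.toReal_pos (by positivity) h
  have hq : (0 : ℝ) < (Fintype.card F : ℝ) ^ 2 := by
    have : 0 < Fintype.card F := Fintype.card_pos
    positivity
  rcases (lpNorm_nonneg p f).eq_or_lt with h0 | h0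
  · obtain ⟨M, -, hM⟩ := exists_le_lpNorm (F := F) p hp
    refine ⟨fun _ => 0, fun _ => le_rfl, by simp, fun x => ?_⟩
    have := (le_abs_self _).trans (hM f x)
    rw [← h0] at this ⊢
    simpa using this
  · refine ⟨fun x => (f x / lpNorm p f) ^ p.toReal,
      fun x => Real.rpow_nonneg (div_nonneg (hf x) h0.le) _, ?_, fun x => ?_⟩
    · have e : lpNorm p f ^ p.toReal =
          ((Fintype.card F : ℝ) ^ 2)⁻¹ * ∑ x, |f x| ^ p.toReal := by
        simp only [lpNorm, h, if_false]
        rw [one_div, Real.rpow_inv_rpow (by positivity) hp0.ne']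
      have hpos : 0 < lpNorm p f ^ p.toReal := Real.rpow_pos_of_pos h0 _
      simp only [Real.div_rpow (hf _) h0.le, ← Finset.sum_div]
      rw [div_le_iff₀ hpos, e, mul_inv_cancel_left₀ hq.ne']
      simp only [abs_of_nonneg (hf _), le_refl]
    · rw [ENNReal.toReal_inv, Real.rpow_rpow_inv (div_nonneg (hf x) h0.le) hp0.ne',
        mul_div_cancel₀ _ h0.ne']

lemma two_div_add_le_two_iff {p₁ p₂ p₃ : ℝ≥0∞} (h₁ : 1 ≤ p₁) (h₂ : 1 ≤ p₂) (h₃ : 1 ≤ p₃) :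
    2 / p₁ + 1 / p₂ + 1 / p₃ ≤ 2 ↔
      2 * (p₁⁻¹).toReal + (p₂⁻¹).toReal + (p₃⁻¹).toReal ≤ 2 := by
  have fin : ∀ {p : ℝ≥0∞}, 1 ≤ p → p⁻¹ ≠ ∞ := fun h =>
    ENNReal.inv_ne_top.2 (zero_lt_one.trans_le h).ne'
  have e : (2 / p₁ + 1 / p₂ + 1 / p₃).toReal =
      2 * (p₁⁻¹).toReal + (p₂⁻¹).toReal + (p₃⁻¹).toReal := by
    rw [div_eq_mul_inv, one_div, one_div, ENNReal.toReal_add, ENNReal.toReal_add,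
      ENNReal.toReal_mul, ENNReal.toReal_ofNat]
    · exact ENNReal.mul_ne_top (by simp) (fin h₁)
    · exact fin h₂
    · exact ENNReal.add_ne_top.2 ⟨ENNReal.mul_ne_top (by simp) (fin h₁), fin h₂⟩
    · exact fin h₃
  rw [← e, ← ENNReal.toReal_ofNat 2, ENNReal.toReal_le_toReal _ (by simp)]
  rw [div_eq_mul_inv, one_div, one_div]
  exact ENNReal.add_ne_top.2 ⟨ENNReal.add_ne_top.2
    ⟨ENNReal.mul_ne_top (by simp) (fin h₁), fin h₂⟩, fin h₃⟩

lemma exponentCondition_iff {p₁ p₂ p₃ : ℝ≥0∞} (h₁ : 1 ≤ p₁) (h₂ : 1 ≤ p₂) (h₃ : 1 ≤ p₃) :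
    ExponentCondition p₁ p₂ p₃ ↔
      2 * (p₁⁻¹).toReal + (p₂⁻¹).toReal + (p₃⁻¹).toReal ≤ 2 ∧
      (p₁⁻¹).toReal + 2 * (p₂⁻¹).toReal + (p₃⁻¹).toReal ≤ 2 ∧
      (p₁⁻¹).toReal + (p₂⁻¹).toReal + 2 * (p₃⁻¹).toReal ≤ 2 := by
  unfold ExponentCondition
  rw [two_div_add_le_two_iff h₁ h₂ h₃, add_comm (1 / p₁), two_div_add_le_two_iff h₂ h₁ h₃,
    add_comm (1 / p₁ + 1 / p₂), ← add_assoc, two_div_add_le_two_iff h₃ h₁ h₂]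
  refine and_congr Iff.rfl (and_congr ?_ ?_) <;> constructor <;> intro h <;> linarith

/-- The strong-type estimate in the whole range of exponents, with an absolute constant. -/
lemma form_le_mul_lpNorm (h2 : (2 : F) ≠ 0) {t : F} (ht : t ≠ 0) {p₁ p₂ p₃ : ℝ≥0∞}
    (h₁ : 1 ≤ p₁) (h₂ : 1 ≤ p₂) (h₃ : 1 ≤ p₃) (hp : ExponentCondition p₁ p₂ p₃)
    (f₁ f₂ f₃ : Plane F → ℝ) (n₁ : ∀ x, 0 ≤ f₁ x) (n₂ : ∀ x, 0 ≤ f₂ x) (n₃ : ∀ x, 0 ≤ f₃ x) :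
    form t f₁ f₂ f₃ ≤ 28 * (lpNorm p₁ f₁ * lpNorm p₂ f₂ * lpNorm p₃ f₃) := by
  obtain ⟨g₁, a₁, b₁, c₁⟩ := exists_density p₁ h₁ f₁ n₁
  obtain ⟨g₂, a₂, b₂, c₂⟩ := exists_density p₂ h₂ f₂ n₂
  obtain ⟨g₃, a₃, b₃, c₃⟩ := exists_density p₃ h₃ f₃ n₃
  obtain ⟨e₁, e₂, e₃⟩ := (exponentCondition_iff h₁ h₂ h₃).1 hp
  have key := sum_triangles_rpow_le_of_exponents (codegreeLeTwo_circleGraph h2 ht)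
    (fun a => (card_circleGraph_adj ht a).trans_le (ncard_circle_le t)) card_plane g₁ g₂ g₃
    a₁ a₂ a₃ b₁ b₂ b₃ ENNReal.toReal_nonneg ENNReal.toReal_nonneg ENNReal.toReal_nonneg e₁ e₂ e₃
  have N₁ := lpNorm_nonneg p₁ f₁
  have N₂ := lpNorm_nonneg p₂ f₂
  have N₃ := lpNorm_nonneg p₃ f₃
  set q : ℝ := (Fintype.card F : ℝ) with hq
  have q0 : 0 < q := by simpa [hq] using Fintype.card_pos (α := F)
  set N := lpNorm p₁ f₁ * lpNorm p₂ f₂ * lpNorm p₃ f₃ with hN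
  have hN0 : 0 ≤ N := by positivity
  have hT : ∑ x ∈ triangles (circleGraph ht), f₁ x.1 * f₂ x.2.1 * f₃ x.2.2 ≤
      N * (7 * q ^ 3) := by
    refine le_trans ?_ (mul_le_mul_of_nonneg_left key hN0)
    rw [Finset.mul_sum]
    refine Finset.sum_le_sum fun x _ => ?_
    calc f₁ x.1 * f₂ x.2.1 * f₃ x.2.2
        ≤ (lpNorm p₁ f₁ * g₁ x.1 ^ (p₁⁻¹).toReal) * (lpNorm p₂ f₂ * g₂ x.2.1 ^ (p₂⁻¹).toReal) *
          (lpNorm p₃ f₃ * g₃ x.2.2 ^ (p₃⁻¹).toReal) :=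
          mul_le_mul (mul_le_mul (c₁ _) (c₂ _) (n₂ _) ((n₁ _).trans (c₁ _))) (c₃ _) (n₃ _)
            (mul_nonneg ((n₁ _).trans (c₁ _)) ((n₂ _).trans (c₂ _)))
      _ = _ := by rw [hN]; ring
  have hS0 : (0 : ℝ) < (circle t).ncard := by exact_mod_cast ncard_circle_pos h2 t
  -- Replacing q by 4|S_t| in the normalization turns 7 into 28.
  have hS : q ≤ 4 * (circle t).ncard := by
    rw [hq]; exact_mod_cast card_le_four_mul_ncard_circle h2 ht
  rw [form_eq_sum_triangles ht, one_div_mul_eq_div, div_le_iff₀ (by positivity)]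
  refine hT.trans ?_
  have := mul_le_mul_of_nonneg_left hS (by positivity : 0 ≤ N * 7 * q ^ 2)
  nlinarith [this]

/-! ### Necessity of the exponent conditions -/

/-- Nonemptiness matters at p = ∞: the empty set has norm 0, while the right side is 0 ^ 0 = 1. -/
lemma lpNorm_ind {p : ℝ≥0∞} (hp : 1 ≤ p) {E : Set (Plane F)} (hE : E.Nonempty) :
    lpNorm p (ind E) = ((E.ncard : ℝ) / (Fintype.card F : ℝ) ^ 2) ^ (p⁻¹).toReal := by
  by_cases h : p = ∞
  · simp only [lpNorm, h, if_true, ENNReal.inv_top, ENNReal.toReal_zero, Real.rpow_zero]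
    refine le_antisymm (ciSup_le fun x => ?_) ?_
    · rw [abs_of_nonneg (ind_nonneg E x)]
      exact Set.indicator_le_self' (fun _ _ => zero_le_one) x
    · obtain ⟨x, hx⟩ := hE
      refine le_trans (le_of_eq ?_)
        (le_ciSup (f := fun x => |ind E x|) (Set.finite_range _).bddAbove x)
      simp [ind, hx]
  · have hp0 : 0 < p.toReal := ENNReal.toReal_pos (by positivity) h
    simp only [lpNorm, h, if_false]
    have e : ∑ x, |ind E x| ^ p.toReal = (E.ncard : ℝ) := by
      have : ∀ x, |ind E x| ^ p.toReal = if x ∈ E then 1 else 0 := fun x => by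
        by_cases hx : x ∈ E <;> simp [ind, hx, Real.zero_rpow hp0.ne']
      simp only [this, Finset.sum_boole]
      rw [← Set.ncard_coe_finset]
      congr 2; ext x; simp
    rw [e, ENNReal.toReal_inv, one_div, div_eq_inv_mul]

/-- Each x on the circle forms a triangle with 0 and its image under the rotation; these |S_t|
triangles cancel the factor |S_t| of the normalization. -/
lemma le_form_ind (h2 : (2 : F) ≠ 0) (h3 : IsSquare (3 : F)) {t : F} (ht : t ≠ 0) :
    ((Fintype.card F : ℝ) ^ 2)⁻¹ ≤ form t (ind {0}) (ind (circle t)) (ind (circle t)) := by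
  obtain ⟨R, hR⟩ := exists_rotation h2 h3
  have hS0 : (0 : ℝ) < (circle t).ncard := by exact_mod_cast ncard_circle_pos h2 t
  have q0 : (0 : ℝ) < Fintype.card F := by simpa using Fintype.card_pos (α := F)
  have key : ((circle t).ncard : ℝ) ≤ ∑ x ∈ triangles (circleGraph ht),
      ind {0} x.1 * ind (circle t) x.2.1 * ind (circle t) x.2.2 := by
    set I : Finset (Plane F × Plane F × Plane F) :=
      ({x : Plane F | x ∈ circle t} : Finset (Plane F)).image (fun x => (0, x, R x)) with hI
    have hcard : #I = (circle t).ncard := by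
      rw [ncard_circle, hI, Finset.card_image_of_injective]
      intro x y h
      simp only [Prod.mk.injEq] at h
      exact h.2.1
    have hsub : I ⊆ triangles (circleGraph ht) := by
      intro y hy
      obtain ⟨x, hx, rfl⟩ := Finset.mem_image.1 hy
      simp only [Finset.mem_filter, Finset.mem_univ, true_and] at hx
      simp only [triangles, Finset.mem_filter, Finset.mem_univ, true_and]
      simp only [circleGraph_adj, zero_sub, sub_zero]
      exact ⟨neg_mem_circle hx, (hR t x hx).2, (hR t x hx).1⟩
    refine le_trans (le_of_eq ?_) (Finset.sum_le_sum_of_subset_of_nonneg hsub fun y _ _ =>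
      mul_nonneg (mul_nonneg (ind_nonneg _ _) (ind_nonneg _ _)) (ind_nonneg _ _))
    rw [Finset.sum_congr rfl (g := fun _ => (1 : ℝ)), Finset.sum_const, hcard, nsmul_eq_mul,
      mul_one]
    intro y hy
    obtain ⟨x, hx, rfl⟩ := Finset.mem_image.1 hy
    simp only [Finset.mem_filter, Finset.mem_univ, true_and] at hx
    simp [ind, hx, (hR t x hx).1]
  rw [form_eq_sum_triangles ht, one_div_mul_eq_div, le_div_iff₀ (by positivity),
    inv_mul_cancel_left₀ (by positivity)]
  exact key

/-- A uniform bound forces the first inequality between the exponents. -/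
lemma exponent_le_of_form_le {𝒬 : Set Datum} (h𝒬 : Unbounded 𝒬) {p₁ p₂ p₃ : ℝ≥0∞}
    (h₁ : 1 ≤ p₁) (h₂ : 1 ≤ p₂) (h₃ : 1 ≤ p₃) {C : ℝ} (hC : 0 ≤ C)
    (h : ∀ D ∈ 𝒬, ∀ f₁ f₂ f₃ : Plane D.F → ℝ, (∀ x, 0 ≤ f₁ x) → (∀ x, 0 ≤ f₂ x) →
      (∀ x, 0 ≤ f₃ x) →
        form D.t f₁ f₂ f₃ ≤ C * (lpNorm p₁ f₁ * lpNorm p₂ f₂ * lpNorm p₃ f₃)) :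
    2 * (p₁⁻¹).toReal + (p₂⁻¹).toReal + (p₃⁻¹).toReal ≤ 2 := by
  have le1 : ∀ {p : ℝ≥0∞}, 1 ≤ p → (p⁻¹).toReal ≤ 1 := fun hp =>
    ENNReal.toReal_le_of_le_ofReal zero_le_one (by simpa using hp)
  set u₁ := (p₁⁻¹).toReal with hu₁
  set u₂ := (p₂⁻¹).toReal with hu₂
  set u₃ := (p₃⁻¹).toReal with hu₃
  have bound : ∀ D ∈ 𝒬, (D.q : ℝ) ^ (2 * u₁ + u₂ + u₃ - 2) ≤ 4 * C := by
    intro D hD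
    have hk := (le_form_ind D.two_ne_zero D.isSquare_three D.t_ne_zero).trans
      (h D hD _ _ _ (ind_nonneg _) (ind_nonneg _) (ind_nonneg _))
    have q0 : (0 : ℝ) < D.q := by simpa [Datum.q] using Fintype.card_pos (α := D.F)
    rw [lpNorm_ind h₁ (Set.singleton_nonempty _),
      lpNorm_ind h₂ (exists_mem_circle D.two_ne_zero D.t),
      lpNorm_ind h₃ (exists_mem_circle D.two_ne_zero D.t), Set.ncard_singleton] at hk
    have hS : ((circle D.t).ncard : ℝ) ≤ 2 * D.q := by exact_mod_cast ncard_circle_le D.t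
    change ((D.q : ℝ) ^ 2)⁻¹ ≤ C * ((((1 : ℕ) : ℝ) / (D.q : ℝ) ^ 2) ^ u₁ *
      (((circle D.t).ncard : ℝ) / (D.q : ℝ) ^ 2) ^ u₂ *
      (((circle D.t).ncard : ℝ) / (D.q : ℝ) ^ 2) ^ u₃) at hk
    -- From |S_t| ≤ 2q, with 2 ^ u ≤ 2; used for both circles, it produces the 4 in `bound`.
    have hc : ∀ {u : ℝ}, 0 ≤ u → u ≤ 1 →
        (((circle D.t).ncard : ℝ) / (D.q : ℝ) ^ 2) ^ u ≤ 2 * (D.q : ℝ) ^ (-u) := by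
      intro u hu0 hu1
      calc (((circle D.t).ncard : ℝ) / (D.q : ℝ) ^ 2) ^ u ≤ (2 * (D.q : ℝ)⁻¹) ^ u := by
            refine Real.rpow_le_rpow (by positivity) ?_ hu0
            rw [div_le_iff₀ (by positivity)]
            refine hS.trans_eq ?_
            field_simp
        _ = 2 ^ u * (D.q : ℝ) ^ (-u) := by
            rw [Real.mul_rpow (by norm_num) (by positivity), Real.inv_rpow q0.le,
              Real.rpow_neg q0.le]
        _ ≤ 2 * (D.q : ℝ) ^ (-u) := by
            gcongr
            exact (Real.rpow_le_rpow_of_exponent_le (by norm_num) hu1).trans_eq (Real.rpow_one 2)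
    have h1 : (((1 : ℕ) : ℝ) / (D.q : ℝ) ^ 2) ^ u₁ = (D.q : ℝ) ^ (-(2 * u₁)) := by
      rw [Nat.cast_one, one_div, Real.inv_rpow (by positivity), ← Real.rpow_natCast,
        ← Real.rpow_mul q0.le, Real.rpow_neg q0.le]
      norm_num
    have h4 : ((D.q : ℝ) ^ 2)⁻¹ ≤ 4 * C * (D.q : ℝ) ^ (-(2 * u₁ + u₂ + u₃)) := by
      rw [h1] at hk
      calc ((D.q : ℝ) ^ 2)⁻¹ ≤ _ := hk
        _ ≤ C * ((D.q : ℝ) ^ (-(2 * u₁)) * (2 * (D.q : ℝ) ^ (-u₂)) * (2 * (D.q : ℝ) ^ (-u₃))) := by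
            have := hc (u := u₂) ENNReal.toReal_nonneg (le1 h₂)
            have := hc (u := u₃) ENNReal.toReal_nonneg (le1 h₃)
            gcongr
        _ = _ := by
            rw [show -(2 * u₁ + u₂ + u₃) = -(2 * u₁) + -u₂ + -u₃ by ring, Real.rpow_add q0,
              Real.rpow_add q0]
            ring
    rw [Real.rpow_sub q0, div_eq_mul_inv, Real.rpow_ofNat]
    calc (D.q : ℝ) ^ (2 * u₁ + u₂ + u₃) * ((D.q : ℝ) ^ 2)⁻¹
        ≤ (D.q : ℝ) ^ (2 * u₁ + u₂ + u₃) * (4 * C * (D.q : ℝ) ^ (-(2 * u₁ + u₂ + u₃))) := by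
          gcongr
      _ = 4 * C * ((D.q : ℝ) ^ (2 * u₁ + u₂ + u₃) * (D.q : ℝ) ^ (-(2 * u₁ + u₂ + u₃))) := by ring
      _ = 4 * C := by rw [← Real.rpow_add q0, add_neg_cancel, Real.rpow_zero, mul_one]
  by_contra! hlt
  obtain ⟨N, hN⟩ := Filter.eventually_atTop.1
    (((tendsto_rpow_atTop (sub_pos.2 hlt)).comp tendsto_natCast_atTop_atTop).eventually_gt_atTop
      (4 * C))
  obtain ⟨D, hD, hq⟩ := h𝒬 N
  exact (hN D.q hq).not_ge (bound D hD)

end Circle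

/-! ### The two directions of the theorem -/

theorem exponentCondition_of_lesssimOne {𝒬 : Set Datum} (h𝒬 : Unbounded 𝒬) {p₁ p₂ p₃ : ℝ≥0∞}
    (h₁ : 1 ≤ p₁) (h₂ : 1 ≤ p₂) (h₃ : 1 ≤ p₃) (h : LesssimOne 𝒬 p₁ p₂ p₃) :
    ExponentCondition p₁ p₂ p₃ := by
  obtain ⟨C, hC1, hC⟩ := h
  have hC0 : 0 ≤ C := zero_le_one.trans hC1
  have H : ∀ D ∈ 𝒬, ∀ f₁ f₂ f₃ : Plane D.F → ℝ, (∀ x, 0 ≤ f₁ x) → (∀ x, 0 ≤ f₂ x) →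
      (∀ x, 0 ≤ f₃ x) →
        form D.t f₁ f₂ f₃ ≤ C * (lpNorm p₁ f₁ * lpNorm p₂ f₂ * lpNorm p₃ f₃) :=
    fun D hD f₁ f₂ f₃ n₁ n₂ n₃ =>
      (form_le_bestConst D.t p₁ p₂ p₃ h₁ h₂ h₃ f₁ f₂ f₃ n₁ n₂ n₃).trans
        (mul_le_mul_of_nonneg_right (hC D hD) (mul_nonneg (mul_nonneg (lpNorm_nonneg _ _)
          (lpNorm_nonneg _ _)) (lpNorm_nonneg _ _)))
  rw [exponentCondition_iff h₁ h₂ h₃]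
  refine ⟨exponent_le_of_form_le h𝒬 h₁ h₂ h₃ hC0 H, ?_, ?_⟩
  · have := exponent_le_of_form_le h𝒬 h₂ h₁ h₃ hC0 fun D hD f₂ f₁ f₃ n₂ n₁ n₃ =>
      ((form_swap D.t_ne_zero f₁ f₂ f₃).trans_le (H D hD f₁ f₂ f₃ n₁ n₂ n₃)).trans_eq (by ring)
    linarith
  · have := exponent_le_of_form_le h𝒬 h₃ h₁ h₂ hC0 fun D hD f₃ f₁ f₂ n₃ n₁ n₂ =>
      ((form_rotate D.t_ne_zero f₃ f₁ f₂).ge.trans (H D hD f₁ f₂ f₃ n₁ n₂ n₃)).trans_eq (by ring)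
    linarith

/-- The constant 28 is uniform over the whole closed region, (2, 2, 2) included. -/
theorem lesssimOne_of_exponentCondition {p₁ p₂ p₃ : ℝ≥0∞} (h₁ : 1 ≤ p₁) (h₂ : 1 ≤ p₂)
    (h₃ : 1 ≤ p₃) (h : ExponentCondition p₁ p₂ p₃) : LesssimOne Set.univ p₁ p₂ p₃ :=
  ⟨28, by norm_num, fun D _ => csInf_le ⟨0, fun _ hC => hC.1.le⟩ ⟨by norm_num,
    form_le_mul_lpNorm D.two_ne_zero D.t_ne_zero h₁ h₂ h₃ h⟩⟩

theorem restrictedStrongType_two : RestrictedStrongType Set.univ 2 2 2 := by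
  have h : (1 : ℝ≥0∞) ≤ 2 := one_le_two
  refine ⟨28, by norm_num, fun D _ E₁ E₂ E₃ => form_le_mul_lpNorm D.two_ne_zero D.t_ne_zero h h h
    ((exponentCondition_iff h h h).2 ?_) _ _ _ (ind_nonneg _) (ind_nonneg _) (ind_nonneg _)⟩
  rw [ENNReal.toReal_inv, ENNReal.toReal_ofNat]
  norm_num

end KThree

theorem theorem4p9 :
    (∀ p₁ p₂ p₃ : ENNReal, 1 ≤ p₁ → 1 ≤ p₂ → 1 ≤ p₃ →
      (∀ 𝒬 : Set KThree.Datum, KThree.Unbounded 𝒬 →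
        KThree.LesssimOne 𝒬 p₁ p₂ p₃ → KThree.ExponentCondition p₁ p₂ p₃) ∧
      (KThree.ExponentCondition p₁ p₂ p₃ → (p₁, p₂, p₃) ≠ (2, 2, 2) →
        KThree.LesssimOne Set.univ p₁ p₂ p₃)) ∧
    KThree.RestrictedStrongType Set.univ 2 2 2 :=
  ⟨fun _ _ _ h₁ h₂ h₃ =>
    ⟨fun _ h𝒬 h => KThree.exponentCondition_of_lesssimOne h𝒬 h₁ h₂ h₃ h,
      fun h _ => KThree.lesssimOne_of_exponentCondition h₁ h₂ h₃ h⟩,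
    KThree.restrictedStrongType_two⟩
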